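/- **Multi-level Nekrasov equations for $\theta\neq 1$.** Let $N\in\mathbb N$, $k\in\{1,\dots,N\}$, $M\in\mathbb Z_{\ge 0}$, $\theta>0$, $\theta\ne1$. Let $\mathfrak X$ be the finite set of arrays $\ell=(\ell^N,\ell^{N-1},\dots,\ell^k)$, $\ell^j=(\ell^j_1,\dots,\ell^j_j)$, with $\ell^j_p=\lambda^j_p-p\theta$, where the $\lambda^j_p$ are integers with $M\ge\lambda^j_1\ge\dots\ge\lambda^j_j\ge0$ for $k\le j\le N$ and $\lambda^{j+1}_p\ge\lambda^j_p\ge\lambda^{j+1}_{p+1}$ for $k\le j<N$, $1\le p\le j$. For $k\le j\le N$ let $w_j$ be a complex-valued function that does not vanish on $[-j\theta,M-\theta]$, and put $$H^t(\ell^N)=\prod_{1\le p<q\le N}\frac{\Gamma(\ell^N_p-\ell^N_q+1)}{\Gamma(\ell^N_p-\ell^N_q+1-\theta)}\prod_{p=1}^Nw_N(\ell^N_p),\qquad H^b(\ell^k)=\prod_{1\le p<q\le k}\frac{\Gamma(\ell^k_p-\ell^k_q+\theta)}{\Gamma(\ell^k_p-\ell^k_q)},$$ $$\begin{aligned}I(\ell^{j+1},\ell^j)=&\prod_{1\le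 p<q\le j+1}\frac{\Gamma(\ell^{j+1}_p-\ell^{j+1}_q+1-\theta)}{\Gamma(\ell^{j+1}_p-\ell^{j+1}_q)}\prod_{1\le p<q\le j}\frac{\Gamma(\ell^j_p-\ell^j_q+1)}{\Gamma(\ell^j_p-\ell^j_q+\theta)}\\&\times\prod_{1\le p<q\le j+1}\frac{\Gamma(\ell^j_p-\ell^{j+1}_q)}{\Gamma(\ell^j_p-\ell^{j+1}_q+1-\theta)}\prod_{1\le p\le q\le j}\frac{\Gamma(\ell^{j+1}_p-\ell^j_q+\theta)}{\Gamma(\ell^{j+1}_p-\ell^j_q+1)}\prod_{p=1}^jw_j(\ell^j_p).\end{aligned}$$ Assume that $Z=\sum_{\ell\in\mathfrak X}H^t(\ell^N)H^b(\ell^k)\prod_{j=k}^{N-1}I(\ell^{j+1},\ell^j)$ is non-zero, let $\mathbb P(\ell)=Z^{-1}H^t(\ell^N)H^b(\ell^k)\prod_{j=k}^{N-1}I(\ell^{j+1},\ell^j)$ be the corresponding complex measure of total mass one, and write $\mathbb E[f]=\sum_{\ell\in\mathfrak X}\mathbb P(\ell)f(\ell)$. Let $\mathcal M\subseteq\mathbb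 C$ be open with $[-N\theta,M+1-\theta]\subseteq\mathcal M$, and let $\phi^j_r$ ($k\le j\le N+1$, $r=1,2$) be analytic functions on $\mathcal M$ such that for every $j\in\{k,\dots,N\}$ $$\phi_1^{j+1}(z)\,w_j(z)=\phi_1^j(z)\,w_j(z-1)\quad\text{for }z\in[1-j\theta,\,M-\theta],$$ $$\phi_2^{j}(z)\,w_j(z+(N-j)\theta)=\phi_2^{j+1}(z)\,w_j(z+(N-j)\theta-1)\quad\text{for }z\in[1-N\theta,\,M-(N-j+1)\theta].$$ Put $s_M=M+1-\theta$ and define $$\begin{aligned}R_1(z)=\;&\phi_1^{N+1}(z)\,\mathbb E\Big[\prod_{p=1}^N\frac{z-\ell^N_p-\theta}{z-\ell^N_p}\Big]+\phi_1^k(z)\,\mathbb E\Big[\prod_{p=1}^k\frac{z-\ell^k_p+\theta-1}{z-\ell^k_p-1}\Big]\\&+\frac{\theta}{1-\theta}\sum_{j=k+1}^N\phi_1^j(z)\,\mathbb E\Big[\prod_{p=1}^j\frac{z-\ell^j_p-\theta}{z-\ell^j_p-1}\prod_{p=1}^{j-1}\frac{z-\ell^{j-1}_p+\theta-1}{z-\ell^{j-1}_p}\Big]-\mathrm{Res}_1(z),\end{aligned}$$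 $$\begin{aligned}R_2(z)=\;&\phi_2^{N+1}(z)\,\mathbb E\Big[\prod_{p=1}^N\frac{z-\ell^N_p+\theta-1}{z-\ell^N_p-1}\Big]+\phi_2^k(z)\,\mathbb E\Big[\prod_{p=1}^k\frac{z-\ell^k_p+(N-k-1)\theta}{z-\ell^k_p+(N-k)\theta}\Big]\\&+\frac{\theta}{1-\theta}\sum_{j=k+1}^N\phi_2^j(z)\,\mathbb E\Big[\prod_{p=1}^j\frac{z-\ell^j_p+(N-j+1)\theta-1}{z-\ell^j_p+(N-j)\theta}\prod_{p=1}^{j-1}\frac{z-\ell^{j-1}_p+(N-j)\theta}{z-\ell^{j-1}_p+(N-j+1)\theta-1}\Big]-\mathrm{Res}_2(z),\end{aligned}$$ where $$\begin{aligned}\mathrm{Res}_1(z)=\;&\frac{(-\theta)\,\phi_1^{N+1}(-N\theta)}{z+N\theta}\,\mathbb E\Big[\prod_{p=1}^{N-1}\frac{\ell^N_p+(N+1)\theta}{\ell^N_p+N\theta}\,\mathbf 1\{\ell^N_N=-N\theta\}\Big]\\&+\frac{\theta\,\phi_1^k(s_M)}{z-s_M}\,\mathbb E\Big[\prod_{p=2}^k\frac{s_M-\ell^k_p+\theta-1}{s_M-\ell^k_p-1}\,\mathbf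 1\{\ell^k_1=s_M-1\}\Big]\\&+\sum_{j=k+1}^N\frac{\theta\,\phi_1^j(s_M)}{z-s_M}\,\mathbb E\Big[\prod_{p=2}^j\frac{s_M-\ell^j_p-\theta}{s_M-\ell^j_p-1}\prod_{p=1}^{j-1}\frac{s_M-\ell^{j-1}_p+\theta-1}{s_M-\ell^{j-1}_p}\,\mathbf 1\{\ell^j_1=s_M-1\}\Big],\end{aligned}$$ $$\begin{aligned}\mathrm{Res}_2(z)=\;&\frac{\theta\,\phi_2^{N+1}(s_M)}{z-s_M}\,\mathbb E\Big[\prod_{p=2}^N\frac{s_M-\ell^N_p+\theta-1}{s_M-\ell^N_p-1}\,\mathbf 1\{\ell^N_1=s_M-1\}\Big]\\&+\frac{(-\theta)\,\phi_2^k(-N\theta)}{z+N\theta}\,\mathbb E\Big[\prod_{p=1}^{k-1}\frac{\ell^k_p+(k+1)\theta}{\ell^k_p+k\theta}\,\mathbf 1\{\ell^k_k=-k\theta\}\Big]\\&+\sum_{j=k+1}^N\frac{(-\theta)\,\phi_2^j(-N\theta)}{z+N\theta}\,\mathbb E\Big[\prod_{p=1}^{j-1}\frac{\ell^j_p+(j-1)\theta+1}{\ell^j_p+j\theta}\prod_{p=1}^{j-1}\frac{\ell^{j-1}_p+j\theta}{\ell^{j-1}_p+(j-1)\theta+1}\,\mathbf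 1\{\ell^j_j=-j\theta\}\Big].\end{aligned}$$ Then $R_1$ and $R_2$ are analytic in $\mathcal M$; that is, for $r=1,2$ there is an analytic function on $\mathcal M$ that agrees with $R_r$ at every point of $\mathcal M$ outside the finite set $\{a-b\theta: a\in\{0,\dots,M+1\},\ b\in\{1,\dots,N\}\}$, which contains all zeros of the denominators above. -/

import Mathlib

open Finset

/-- Integer arrays `(λ^N, …, λ^k)`: the `p`-th coordinate of level `j` is `lam j p`, for
`k ≤ j ≤ N` and `1 ≤ p ≤ j`; entries with other indices carry no information and are set to `0`.
Every level is a partition with parts in `[0, M]`, and consecutive levels interlace. -/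
def IsGTArray (N k M : ℕ) (lam : ℕ → ℕ → ℤ) : Prop :=
  (∀ j p, ¬ (k ≤ j ∧ j ≤ N ∧ 1 ≤ p ∧ p ≤ j) → lam j p = 0) ∧
  (∀ j p, k ≤ j → j ≤ N → 1 ≤ p → p ≤ j → 0 ≤ lam j p ∧ lam j p ≤ (M : ℤ)) ∧
  (∀ j p, k ≤ j → j ≤ N → 1 ≤ p → p < j → lam j (p + 1) ≤ lam j p) ∧
  (∀ j p, k ≤ j → j < N → 1 ≤ p → p ≤ j →
    lam j p ≤ lam (j + 1) p ∧ lam (j + 1) (p + 1) ≤ lam j p)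

theorem finite_setOf_isGTArray (N k M : ℕ) : {lam | IsGTArray N k M lam}.Finite := by
  have hb : ∀ lam, IsGTArray N k M lam → ∀ j p, lam j p ∈ Set.Icc (0 : ℤ) M := by
    intro lam h j p
    by_cases hjp : k ≤ j ∧ j ≤ N ∧ 1 ≤ p ∧ p ≤ j
    · exact h.2.1 j p hjp.1 hjp.2.1 hjp.2.2.1 hjp.2.2.2
    · rw [h.1 j p hjp]
      exact ⟨le_refl _, by positivity⟩
  let f : {lam // IsGTArray N k M lam} → (Fin (N + 1) → Fin (N + 1) → Set.Icc (0 : ℤ) M) :=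
    fun l a b => ⟨l.1 a b, hb l.1 l.2 a b⟩
  have hf : Function.Injective f := by
    rintro ⟨l, hl⟩ ⟨m, hm⟩ h
    apply Subtype.ext
    funext j p
    by_cases hjp : k ≤ j ∧ j ≤ N ∧ 1 ≤ p ∧ p ≤ j
    · have h1 := congrFun (congrFun h ⟨j, by omega⟩) ⟨p, by omega⟩
      exact congrArg Subtype.val h1
    · change l j p = m j p
      rw [hl.1 j p hjp, hm.1 j p hjp]
  exact Set.finite_coe_iff.mp (Finite.of_injective f hf)

/-- The (finite) state space, in the integer coordinates `λ`. -/
noncomputable def gtArrays (N k M : ℕ) : Finset (ℕ → ℕ → ℤ) :=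
  (finite_setOf_isGTArray N k M).toFinset

/-- The particle locations `ℓ^j_p = λ^j_p - p θ`. -/
noncomputable def particle (θ : ℝ) (lam : ℕ → ℕ → ℤ) (j p : ℕ) : ℝ := (lam j p : ℝ) - p * θ

/-- The interaction `I(ℓ^{j+1}, ℓ^j)` of levels `j + 1` and `j`, including the weight `w_j`. -/
noncomputable def levelInteraction (θ : ℝ) (w : ℕ → ℝ → ℂ) (ℓ : ℕ → ℕ → ℝ) (j : ℕ) : ℂ :=
  ((((∏ q ∈ Icc 1 (j + 1), ∏ p ∈ Ico 1 q,
        Real.Gamma (ℓ (j + 1) p - ℓ (j + 1) q + 1 - θ) / Real.Gamma (ℓ (j + 1) p - ℓ (j + 1) q)) *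
      (∏ q ∈ Icc 1 j, ∏ p ∈ Ico 1 q,
        Real.Gamma (ℓ j p - ℓ j q + 1) / Real.Gamma (ℓ j p - ℓ j q + θ)) *
      (∏ q ∈ Icc 1 (j + 1), ∏ p ∈ Ico 1 q,
        Real.Gamma (ℓ j p - ℓ (j + 1) q) / Real.Gamma (ℓ j p - ℓ (j + 1) q + 1 - θ)) *
      (∏ q ∈ Icc 1 j, ∏ p ∈ Icc 1 q,
        Real.Gamma (ℓ (j + 1) p - ℓ j q + θ) / Real.Gamma (ℓ (j + 1) p - ℓ j q + 1)) : ℝ)) : ℂ) *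
    ∏ p ∈ Icc 1 j, w j (ℓ j p)

/-- The top-level factor `H^t(ℓ^N)`, including the weight `w_N`. -/
noncomputable def topFactor (θ : ℝ) (w : ℕ → ℝ → ℂ) (ℓ : ℕ → ℕ → ℝ) (N : ℕ) : ℂ :=
  ((∏ q ∈ Icc 1 N, ∏ p ∈ Ico 1 q,
      Real.Gamma (ℓ N p - ℓ N q + 1) / Real.Gamma (ℓ N p - ℓ N q + 1 - θ) : ℝ) : ℂ) *
    ∏ p ∈ Icc 1 N, w N (ℓ N p)

/-- The bottom-level factor `H^b(ℓ^k)`. -/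
noncomputable def bottomFactor (θ : ℝ) (ℓ : ℕ → ℕ → ℝ) (k : ℕ) : ℂ :=
  ((∏ q ∈ Icc 1 k, ∏ p ∈ Ico 1 q,
      Real.Gamma (ℓ k p - ℓ k q + θ) / Real.Gamma (ℓ k p - ℓ k q) : ℝ) : ℂ)

/-- The unnormalized weight `H^t(ℓ^N) H^b(ℓ^k) ∏_{j=k}^{N-1} I(ℓ^{j+1}, ℓ^j)`. -/
noncomputable def gtWeight (N k : ℕ) (θ : ℝ) (w : ℕ → ℝ → ℂ) (ℓ : ℕ → ℕ → ℝ) : ℂ :=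
  topFactor θ w ℓ N * bottomFactor θ ℓ k * ∏ j ∈ Ico k N, levelInteraction θ w ℓ j

/-- The normalization constant `Z_N`. -/
noncomputable def gtPartition (N k M : ℕ) (θ : ℝ) (w : ℕ → ℝ → ℂ) : ℂ :=
  ∑ lam ∈ gtArrays N k M, gtWeight N k θ w (particle θ lam)

/-- The mass that the complex measure assigns to a configuration `ℓ`. -/
noncomputable def gtProb (N k M : ℕ) (θ : ℝ) (w : ℕ → ℝ → ℂ) (ℓ : ℕ → ℕ → ℝ) : ℂ :=
  (gtPartition N k M θ w)⁻¹ * gtWeight N k θ w ℓ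

/-- The expectation `E[f(ℓ)]` with respect to the complex measure. -/
noncomputable def gtExp (N k M : ℕ) (θ : ℝ) (w : ℕ → ℝ → ℂ) (f : (ℕ → ℕ → ℝ) → ℂ) : ℂ :=
  ∑ lam ∈ gtArrays N k M, gtProb N k M θ w (particle θ lam) * f (particle θ lam)

/-- The boundary term `Res_1(z)`, with `s_M = M + 1 - θ`. -/
noncomputable def nekRes1 (N k M : ℕ) (θ : ℝ) (w : ℕ → ℝ → ℂ) (φ : ℕ → ℂ → ℂ) (z : ℂ) : ℂ :=
  let sM : ℝ := M + 1 - θ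
  (-(θ : ℂ)) * φ (N + 1) (-(N * θ)) / (z + N * θ) *
      gtExp N k M θ w (fun ℓ =>
        (∏ p ∈ Icc 1 (N - 1), ((ℓ N p : ℂ) + (N + 1) * θ) / ((ℓ N p : ℂ) + N * θ)) *
          (if ℓ N N = -(N * θ) then 1 else 0)) +
  (θ : ℂ) * φ k sM / (z - sM) *
      gtExp N k M θ w (fun ℓ =>
        (∏ p ∈ Icc 2 k, ((sM : ℂ) - ℓ k p + θ - 1) / ((sM : ℂ) - ℓ k p - 1)) *
          (if ℓ k 1 = sM - 1 then 1 else 0)) +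
  ∑ j ∈ Icc (k + 1) N, (θ : ℂ) * φ j sM / (z - sM) *
      gtExp N k M θ w (fun ℓ =>
        (∏ p ∈ Icc 2 j, ((sM : ℂ) - ℓ j p - θ) / ((sM : ℂ) - ℓ j p - 1)) *
        (∏ p ∈ Icc 1 (j - 1),
          ((sM : ℂ) - ℓ (j - 1) p + θ - 1) / ((sM : ℂ) - ℓ (j - 1) p)) *
          (if ℓ j 1 = sM - 1 then 1 else 0))

/-- The boundary term `Res_2(z)`, with `s_M = M + 1 - θ`. The numerator of the product over level
`k` is `ℓ^k_p + (k+1) θ`: this is the value at `z = -Nθ` of the numerator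
`z - ℓ^k_p + (N-k-1) θ` in the second term of `R_2`, up to sign. -/
noncomputable def nekRes2 (N k M : ℕ) (θ : ℝ) (w : ℕ → ℝ → ℂ) (φ : ℕ → ℂ → ℂ) (z : ℂ) : ℂ :=
  let sM : ℝ := M + 1 - θ
  (θ : ℂ) * φ (N + 1) sM / (z - sM) *
      gtExp N k M θ w (fun ℓ =>
        (∏ p ∈ Icc 2 N, ((sM : ℂ) - ℓ N p + θ - 1) / ((sM : ℂ) - ℓ N p - 1)) *
          (if ℓ N 1 = sM - 1 then 1 else 0)) +
  (-(θ : ℂ)) * φ k (-(N * θ)) / (z + N * θ) *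
      gtExp N k M θ w (fun ℓ =>
        (∏ p ∈ Icc 1 (k - 1), ((ℓ k p : ℂ) + (k + 1) * θ) / ((ℓ k p : ℂ) + k * θ)) *
          (if ℓ k k = -(k * θ) then 1 else 0)) +
  ∑ j ∈ Icc (k + 1) N, (-(θ : ℂ)) * φ j (-(N * θ)) / (z + N * θ) *
      gtExp N k M θ w (fun ℓ =>
        (∏ p ∈ Icc 1 (j - 1),
          ((ℓ j p : ℂ) + ((j : ℂ) - 1) * θ + 1) / ((ℓ j p : ℂ) + j * θ)) *
        (∏ p ∈ Icc 1 (j - 1),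
          ((ℓ (j - 1) p : ℂ) + j * θ) / ((ℓ (j - 1) p : ℂ) + ((j : ℂ) - 1) * θ + 1)) *
          (if ℓ j j = -(j * θ) then 1 else 0))

/-- The expression `R_1(z)` (meaningful where no denominator vanishes). -/
noncomputable def nekR1 (N k M : ℕ) (θ : ℝ) (w : ℕ → ℝ → ℂ) (φ : ℕ → ℂ → ℂ) (z : ℂ) : ℂ :=
  φ (N + 1) z * gtExp N k M θ w (fun ℓ =>
      ∏ p ∈ Icc 1 N, (z - ℓ N p - θ) / (z - ℓ N p)) +
  φ k z * gtExp N k M θ w (fun ℓ =>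
      ∏ p ∈ Icc 1 k, (z - ℓ k p + θ - 1) / (z - ℓ k p - 1)) +
  (θ : ℂ) / (1 - θ) * ∑ j ∈ Icc (k + 1) N, φ j z * gtExp N k M θ w (fun ℓ =>
      (∏ p ∈ Icc 1 j, (z - ℓ j p - θ) / (z - ℓ j p - 1)) *
      ∏ p ∈ Icc 1 (j - 1), (z - ℓ (j - 1) p + θ - 1) / (z - ℓ (j - 1) p)) -
  nekRes1 N k M θ w φ z

/-- The expression `R_2(z)` (meaningful where no denominator vanishes). -/
noncomputable def nekR2 (N k M : ℕ) (θ : ℝ) (w : ℕ → ℝ → ℂ) (φ : ℕ → ℂ → ℂ) (z : ℂ) : ℂ :=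
  φ (N + 1) z * gtExp N k M θ w (fun ℓ =>
      ∏ p ∈ Icc 1 N, (z - ℓ N p + θ - 1) / (z - ℓ N p - 1)) +
  φ k z * gtExp N k M θ w (fun ℓ =>
      ∏ p ∈ Icc 1 k,
        (z - ℓ k p + ((N : ℂ) - k - 1) * θ) / (z - ℓ k p + ((N : ℂ) - k) * θ)) +
  (θ : ℂ) / (1 - θ) * ∑ j ∈ Icc (k + 1) N, φ j z * gtExp N k M θ w (fun ℓ =>
      (∏ p ∈ Icc 1 j,
        (z - ℓ j p + ((N : ℂ) - j + 1) * θ - 1) / (z - ℓ j p + ((N : ℂ) - j) * θ)) *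
      ∏ p ∈ Icc 1 (j - 1),
        (z - ℓ (j - 1) p + ((N : ℂ) - j) * θ) /
          (z - ℓ (j - 1) p + ((N : ℂ) - j + 1) * θ - 1)) -
  nekRes2 N k M θ w φ z

/-- The finite set of points `a - b θ` with `0 ≤ a ≤ M + 1` and `1 ≤ b ≤ N`. It contains every
point at which some denominator (as a function of `z`) in `R_1` or `R_2` vanishes. -/
def nekLattice (N M : ℕ) (θ : ℝ) : Set ℂ :=
  {z | ∃ a b : ℕ, a ≤ M + 1 ∧ 1 ≤ b ∧ b ≤ N ∧ z = (a : ℂ) - b * θ}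

/-!
Write `s = a - pθ` for a possible pole. The expression `R₁` is a combination of terms indexed by
`j ∈ {k, …, N + 1}`; the `j`-th one is a product over the particles of level `j`, with poles at
`ℓ^j_p + 1`, and over the particles of level `j - 1`, with poles at `ℓ^{j-1}_p` (for `j = N + 1`
the first product is empty, for `j = k` the second one). By Riemann's theorem on removable
singularities it suffices that the residues at each `s`, summed over all terms and all
configurations, add up to the residue of the boundary term.

The residues cancel in pairs, within a single column `p`. Fix the other columns. If level `j` of
column `p` sits at `s - 1` then it causes a pole at `s` in the `j`-th term; let `m > j` be the first
level at which the column has passed `s - 1` (`m = N + 1` if there is none). Moving column `p` from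
`s - 1` to `s` in the levels `j, …, m - 1` gives a configuration with a pole at `s` in the `m`-th
term, caused by level `m - 1`, and every such pole arises in this way exactly once. The two
weighted residues are opposite to each other:
* when a single particle moves, the ratio of the Gamma factors of the weight is the inverse of the
  ratio of the coefficients of the two poles (`IsGTArray.gammaWeight_move`), and in a chain of
  such moves the intermediate coefficients cancel (`IsGTArray.gammaWeight_shiftCol`);
* the functions `φ_j` compensate the factors `w_j` (`IsGTArray.gtWeight_shiftCol`);
* if the moved configuration violates the interlacing condition, then the coefficient of the
  pole contains a vanishing factor (`sum_block`).

What remains are the positions at the boundary: the first column at `M`, which cannot be moved up,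
and the last column at `0`, which cannot be moved down (`upResidue_sub_lowResidue`). These residues
are the boundary terms of `R₁`.

If `1 / θ` is an integer, both levels in a term can contribute a pole at the same point. Then the
interlacing forces all particles in between into one row, both products have a zero as well, and
the residue is zero (`IsGTArray.eq_of_double_pole`).

The reflection `ℓ^j_p ↦ M - ℓ^j_{j+1-p} - (j+1)θ`, `z ↦ M + 1 - (N+1)θ - z` preserves the weight
and exchanges `R₁` and `R₂` (`nekR1_reflect`), so the second statement follows from the first.
-/

/-! ### Interlacing arrays -/

namespace IsGTArray

variable {N k M : ℕ} {lam : ℕ → ℕ → ℤ}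

theorem anti_row (h : IsGTArray N k M lam) {j p q : ℕ} (hkj : k ≤ j) (hjN : j ≤ N) (hp : 1 ≤ p)
    (hpq : p ≤ q) (hqj : q ≤ j) : lam j q ≤ lam j p := by
  induction q, hpq using Nat.le_induction with
  | base => exact le_refl _
  | succ q hpq ih => exact (h.2.2.1 j q hkj hjN (by omega) (by omega)).trans (ih (by omega))

theorem mono_col (h : IsGTArray N k M lam) {i j p : ℕ} (hki : k ≤ i) (hij : i ≤ j) (hjN : j ≤ N)
    (hp : 1 ≤ p) (hpi : p ≤ i) : lam i p ≤ lam j p := by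
  induction j, hij using Nat.le_induction with
  | base => exact le_refl _
  | succ j hij ih => exact (ih (by omega)).trans (h.2.2.2 j p (by omega) (by omega) hp (by omega)).1

/-- An entry of level `j + 1` lies below every entry of level `j` with smaller index. -/
theorem le_of_lt (h : IsGTArray N k M lam) {j p q : ℕ} (hkj : k ≤ j) (hjN : j < N) (hp : 1 ≤ p)
    (hpq : p < q) (hqj : q ≤ j + 1) : lam (j + 1) q ≤ lam j p := by
  obtain ⟨q, rfl⟩ : ∃ q', q = q' + 1 := ⟨q - 1, by omega⟩
  exact (h.2.2.2 j q hkj hjN (by omega) (by omega)).2.trans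
    (h.anti_row hkj hjN.le hp (by omega) (by omega))

/-- An entry of level `j` lies below every entry of level `j + 1` with the same or smaller
index. -/
theorem le_of_le (h : IsGTArray N k M lam) {j p q : ℕ} (hkj : k ≤ j) (hjN : j < N) (hp : 1 ≤ p)
    (hpq : p ≤ q) (hqj : q ≤ j) : lam j q ≤ lam (j + 1) p :=
  (h.2.2.2 j q hkj hjN (by omega) (by omega)).1.trans
    (h.anti_row (by omega) hjN hp hpq (by omega))

end IsGTArray

@[simp] theorem mem_gtArrays {N k M : ℕ} {lam : ℕ → ℕ → ℤ} :
    lam ∈ gtArrays N k M ↔ IsGTArray N k M lam := by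
  simp [gtArrays]

/-! ### The Gamma factors of the weight -/

/-- The shift in the numerators of the upper-level product of the `j`-th term of `R₁`. -/
noncomputable def upShift (k : ℕ) (θ : ℝ) (j : ℕ) : ℝ := if j = k then 1 - θ else θ

/-- The shift in the numerators of the lower-level product of the `j`-th term of `R₁`. -/
noncomputable def lowShift (N : ℕ) (θ : ℝ) (j : ℕ) : ℝ := if j = N + 1 then θ else 1 - θ

/-- The columns over which the upper-level product of the `j`-th term of `R₁` runs. -/
def upCols (N j : ℕ) : Finset ℕ := if j ≤ N then Icc 1 j else ∅

/-- The columns over which the lower-level product of the `j`-th term of `R₁` runs. -/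
def lowCols (k j : ℕ) : Finset ℕ := if k < j then Icc 1 (j - 1) else ∅

/-- The factor contributed to the weight by two particles of one level at distance `x`. -/
noncomputable def pairFactor (c d x : ℝ) : ℝ :=
  Real.Gamma (x + 1 - c) / Real.Gamma x * (Real.Gamma (x + 1) / Real.Gamma (x + 1 - d))

/-- The factor contributed to the weight by the `r`-th particle `x` of some level and the `q`-th
particle `y` of the level above. -/
noncomputable def crossFactor (θ : ℝ) (r q : ℕ) (x y : ℝ) : ℝ :=
  if r < q then Real.Gamma (x - y) / Real.Gamma (x - y + 1 - θ)
  else Real.Gamma (y - x + θ) / Real.Gamma (y - x + 1)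

/-- The product of all interactions within level `j`. -/
noncomputable def rowFactor (N k : ℕ) (θ : ℝ) (ℓ : ℕ → ℕ → ℝ) (j : ℕ) : ℝ :=
  ∏ q ∈ Icc 1 j, ∏ p ∈ Ico 1 q,
    pairFactor (upShift k θ j) (lowShift N θ (j + 1)) (ℓ j p - ℓ j q)

/-- The product of all interactions between the levels `j` and `j + 1`. -/
noncomputable def linkFactor (θ : ℝ) (ℓ : ℕ → ℕ → ℝ) (j : ℕ) : ℝ :=
  ∏ r ∈ Icc 1 j, ∏ q ∈ Icc 1 (j + 1), crossFactor θ r q (ℓ j r) (ℓ (j + 1) q)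

/-- The part of the weight that does not involve the functions `w_j`. -/
noncomputable def gammaWeight (N k : ℕ) (θ : ℝ) (ℓ : ℕ → ℕ → ℝ) : ℝ :=
  (∏ j ∈ Icc k N, rowFactor N k θ ℓ j) * ∏ j ∈ Ico k N, linkFactor θ ℓ j

theorem linkFactor_eq (θ : ℝ) (ℓ : ℕ → ℕ → ℝ) (j : ℕ) :
    linkFactor θ ℓ j =
      (∏ q ∈ Icc 1 (j + 1), ∏ p ∈ Ico 1 q,
        Real.Gamma (ℓ j p - ℓ (j + 1) q) / Real.Gamma (ℓ j p - ℓ (j + 1) q + 1 - θ)) *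
      (∏ q ∈ Icc 1 j, ∏ p ∈ Icc 1 q,
        Real.Gamma (ℓ (j + 1) p - ℓ j q + θ) / Real.Gamma (ℓ (j + 1) p - ℓ j q + 1)) := by
  have h1 : ∀ F : ℕ → ℕ → ℝ, ∏ q ∈ Icc 1 (j + 1), ∏ p ∈ Ico 1 q, F p q =
      ∏ r ∈ Icc 1 j, ∏ q ∈ Icc 1 (j + 1), if r < q then F r q else 1 := by
    intro F
    rw [prod_comm]
    refine prod_congr rfl fun q hq => ?_
    rw [← prod_filter]
    refine prod_congr ?_ fun _ _ => rfl
    ext r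
    simp only [mem_Icc, mem_Ico, mem_filter] at hq ⊢
    omega
  have h2 : ∀ F : ℕ → ℕ → ℝ, ∏ q ∈ Icc 1 j, ∏ p ∈ Icc 1 q, F p q =
      ∏ r ∈ Icc 1 j, ∏ q ∈ Icc 1 (j + 1), if r < q then 1 else F q r := by
    intro F
    refine prod_congr rfl fun q hq => ?_
    simp_rw [← ite_not (_ < _) (F _ _)]
    rw [← prod_filter]
    refine prod_congr ?_ fun _ _ => rfl
    ext r
    simp only [mem_Icc, mem_filter] at hq ⊢
    omega
  rw [h1, h2, ← prod_mul_distrib, linkFactor]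
  refine prod_congr rfl fun r _ => ?_
  rw [← prod_mul_distrib]
  refine prod_congr rfl fun q _ => ?_
  unfold crossFactor
  split_ifs <;> simp

theorem gtWeight_eq {N k : ℕ} (hkN : k ≤ N) (θ : ℝ) (w : ℕ → ℝ → ℂ) (ℓ : ℕ → ℕ → ℝ) :
    gtWeight N k θ w ℓ =
      (gammaWeight N k θ ℓ : ℂ) * ∏ j ∈ Icc k N, ∏ p ∈ Icc 1 j, w j (ℓ j p) := by
  have hA : ∀ F : ℕ → ℝ, ∏ j ∈ Icc k N, F j = F k * ∏ j ∈ Ico k N, F (j + 1) := by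
    intro F
    rw [prod_Ico_add' F k N 1, ← Finset.Ico_add_one_right_eq_Icc,
      ← Finset.prod_eq_prod_Ico_succ_bot (by omega)]
  have hB : ∀ {R : Type} [CommRing R] (F : ℕ → R),
      ∏ j ∈ Icc k N, F j = (∏ j ∈ Ico k N, F j) * F N := by
    intro R _ F
    rw [← Finset.Ico_add_one_right_eq_Icc, Finset.prod_Ico_succ_top (by omega)]
  have hrow : ∏ j ∈ Icc k N, rowFactor N k θ ℓ j =
      (∏ q ∈ Icc 1 k, ∏ p ∈ Ico 1 q,
        Real.Gamma (ℓ k p - ℓ k q + θ) / Real.Gamma (ℓ k p - ℓ k q)) *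
      (∏ j ∈ Ico k N, ∏ q ∈ Icc 1 (j + 1), ∏ p ∈ Ico 1 q,
        Real.Gamma (ℓ (j + 1) p - ℓ (j + 1) q + 1 - θ) /
          Real.Gamma (ℓ (j + 1) p - ℓ (j + 1) q)) *
      ((∏ j ∈ Ico k N, ∏ q ∈ Icc 1 j, ∏ p ∈ Ico 1 q,
        Real.Gamma (ℓ j p - ℓ j q + 1) / Real.Gamma (ℓ j p - ℓ j q + θ)) *
      (∏ q ∈ Icc 1 N, ∏ p ∈ Ico 1 q,
        Real.Gamma (ℓ N p - ℓ N q + 1) / Real.Gamma (ℓ N p - ℓ N q + 1 - θ))) := by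
    simp only [rowFactor, pairFactor, prod_mul_distrib]
    rw [hA, hB]
    congr 2
    · simp only [upShift, if_true]
      refine prod_congr rfl fun q _ => prod_congr rfl fun p _ => ?_
      ring_nf
    · refine prod_congr rfl fun j hj => prod_congr rfl fun q _ => prod_congr rfl fun p _ => ?_
      rw [mem_Ico] at hj
      rw [upShift, if_neg (by omega)]
    · refine prod_congr rfl fun j hj => prod_congr rfl fun q _ => prod_congr rfl fun p _ => ?_
      rw [mem_Ico] at hj
      rw [lowShift, if_neg (by omega)]
      ring_nf
    · simp only [lowShift, if_true]
  rw [gammaWeight, hrow, hB (R := ℂ)]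
  simp only [gtWeight, topFactor, bottomFactor, levelInteraction, linkFactor_eq, prod_mul_distrib]
  push_cast
  simp only [prod_mul_distrib]
  ring

/-! ### Moving one particle -/

theorem Gamma_div_add_one {t u : ℝ} (ht : t ≠ 0) (hu : u ≠ 0) :
    Real.Gamma (t + 1) / Real.Gamma (u + 1) = Real.Gamma t / Real.Gamma u * (t / u) := by
  rw [Real.Gamma_add_one ht, Real.Gamma_add_one hu]
  ring

/-- If only the entries `(r, p)` and `(p, q)` of a strictly triangular array change, each by a
factor depending on the other index, then the product changes by the product of these factors. -/
theorem prod_pairs_mul {n p : ℕ} {f g : ℕ → ℕ → ℝ} {ρ : ℕ → ℝ} (hp : p ∈ Icc 1 n)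
    (h0 : ∀ r q, r ∈ Icc 1 n → q ∈ Icc 1 n → r < q → r ≠ p → q ≠ p → g r q = f r q)
    (h1 : ∀ q, p < q → q ∈ Icc 1 n → g p q = f p q * ρ q)
    (h2 : ∀ r, r < p → r ∈ Icc 1 n → g r p = f r p * ρ r) :
    ∏ q ∈ Icc 1 n, ∏ r ∈ Ico 1 q, g r q =
      (∏ q ∈ Icc 1 n, ∏ r ∈ Ico 1 q, f r q) * ∏ q ∈ (Icc 1 n).erase p, ρ q := by
  have key : ∀ q ∈ Icc 1 n, ∏ r ∈ Ico 1 q, g r q =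
      (∏ r ∈ Ico 1 q, f r q) *
        ((if q = p then ∏ r ∈ Ico 1 p, ρ r else 1) * (if p < q then ρ q else 1)) := by
    intro q hq
    rw [mem_Icc] at hq hp
    rcases lt_trichotomy q p with h | h | h
    · rw [if_neg h.ne, if_neg h.not_gt, mul_one, mul_one]
      refine prod_congr rfl fun r hr => ?_
      rw [mem_Ico] at hr
      exact h0 r q (by rw [mem_Icc]; omega) (by rw [mem_Icc]; omega) hr.2 (by omega) (by omega)
    · subst h
      rw [if_pos rfl, if_neg (lt_irrefl _), mul_one, ← prod_mul_distrib]
      refine prod_congr rfl fun r hr => ?_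
      rw [mem_Ico] at hr
      exact h2 r hr.2 (by rw [mem_Icc]; omega)
    · rw [if_neg h.ne', if_pos h, one_mul,
        ← mul_prod_erase (Ico 1 q) _ (show p ∈ Ico 1 q by rw [mem_Ico]; omega),
        ← mul_prod_erase (Ico 1 q) (fun r => f r q) (show p ∈ Ico 1 q by rw [mem_Ico]; omega),
        h1 q h (by rw [mem_Icc]; omega)]
      have : ∏ r ∈ (Ico 1 q).erase p, g r q = ∏ r ∈ (Ico 1 q).erase p, f r q := by
        refine prod_congr rfl fun r hr => ?_
        rw [mem_erase, mem_Ico] at hr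
        exact h0 r q (by rw [mem_Icc]; omega) (by rw [mem_Icc]; omega) hr.2.2 hr.1 h.ne'
      rw [this]
      ring
  rw [prod_congr rfl key, prod_mul_distrib, prod_mul_distrib]
  congr 1
  rw [prod_ite_eq' (Icc 1 n) p, if_pos hp, ← prod_filter, ← prod_union]
  · refine prod_congr ?_ fun _ _ => rfl
    ext r
    simp only [mem_Icc, mem_union, mem_Ico, mem_filter, mem_erase] at hp ⊢
    omega
  · rw [disjoint_left]
    intro r hr hr'
    simp only [mem_Icc, mem_Ico, mem_filter] at hr hr'
    omega

theorem pairFactor_add_one {c d x : ℝ} (hx : x ≠ 0) (hc : x + 1 - c ≠ 0) (hx1 : x + 1 ≠ 0)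
    (hd : x + 1 - d ≠ 0) :
    pairFactor c d (x + 1) =
      pairFactor c d x * ((x + 1 - c) / x * ((x + 1) / (x + 1 - d))) := by
  unfold pairFactor
  rw [show x + 1 + 1 - c = x + 1 - c + 1 by ring, show x + 1 + 1 - d = x + 1 - d + 1 by ring,
    Gamma_div_add_one hc hx, Gamma_div_add_one hx1 hd]
  ring

/-- The effect of moving a particle from `s - 1` to `s` on its interaction with a smaller particle
`y` of its level. -/
theorem pairFactor_move_left {c d s y : ℝ} (h0 : 0 < s - 1 - y) (hc : 0 < s - y - c)
    (hd : 0 < s - y - d) :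
    pairFactor c d (s - y) =
      pairFactor c d (s - 1 - y) *
        ((s - y) * (s - y - c) / ((s - y - 1) * (s - y - d))) := by
  have := pairFactor_add_one (c := c) (d := d) (x := s - 1 - y) h0.ne' (by linarith) (by linarith)
    (by linarith)
  rw [show s - 1 - y + 1 = s - y by ring] at this
  rw [this]
  congr 1
  rw [show s - 1 - y = s - y - 1 by ring]
  field_simp

/-- The effect of moving a particle from `s - 1` to `s` on its interaction with a larger particle `y`
of its level. The factor is the one for smaller particles because the two shifts coincide or sum
up to `1`. -/
theorem pairFactor_move_right {c d s y : ℝ} (hcd : c = d ∨ c + d = 1) (h0 : 0 < y - s)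
    (hc : 0 < y - s + 1 - c) (hd : 0 < y - s + 1 - d) (hc' : s - y - c ≠ 0) :
    pairFactor c d (y - s) =
      pairFactor c d (y - (s - 1)) *
        ((s - y) * (s - y - c) / ((s - y - 1) * (s - y - d))) := by
  have := pairFactor_add_one (c := c) (d := d) (x := y - s) h0.ne' hc.ne' (by linarith) hd.ne'
  rw [show y - (s - 1) = y - s + 1 by ring, this, mul_assoc]
  have e1 : (y - s + 1 - c) / (y - s) * ((y - s + 1) / (y - s + 1 - d)) *
      ((s - y) * (s - y - c) / ((s - y - 1) * (s - y - d))) = 1 := by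
    have n1 : s - y - 1 ≠ 0 := by linarith
    rcases hcd with rfl | hcd
    · field_simp
      ring
    · have : d = 1 - c := by linarith
      subst this
      have n2 : s - y - (1 - c) ≠ 0 := by linarith
      have n3 : y - s + 1 - (1 - c) ≠ 0 := hd.ne'
      field_simp
      ring
  rw [e1, mul_one]

/-- The effect of moving a particle from `s - 1` to `s` on its interaction with a particle `y` of the
level above. The factor does not depend on the order of the two particles. -/
theorem crossFactor_move_lower {θ s y : ℝ} {r q : ℕ} (h1 : r < q → 0 < s - 1 - y ∧ 0 < s - y - θ)
    (h2 : q ≤ r → 0 < y - s + θ ∧ 0 < y - s + 1) :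
    crossFactor θ r q s y = crossFactor θ r q (s - 1) y * ((s - y - 1) / (s - y - θ)) := by
  unfold crossFactor
  split_ifs with h
  · obtain ⟨a, b⟩ := h1 h
    rw [show s - y = s - 1 - y + 1 by ring,
      show s - 1 - y + 1 + 1 - θ = s - 1 - y + 1 - θ + 1 by ring,
      Gamma_div_add_one a.ne' (by linarith)]
    ring
  · obtain ⟨a, b⟩ := h2 (not_lt.1 h)
    rw [show y - (s - 1) + θ = y - s + θ + 1 by ring, show y - (s - 1) + 1 = y - s + 1 + 1 by ring,
      Gamma_div_add_one a.ne' b.ne', mul_assoc, show s - y - 1 = -(y - s + 1) by ring,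
      show s - y - θ = -(y - s + θ) by ring, neg_div_neg_eq]
    field_simp

/-- The effect of moving a particle from `s - 1` to `s` on its interaction with a particle `x` of the
level below. -/
theorem crossFactor_move_upper {θ s x : ℝ} {r q : ℕ}
    (h1 : r < q → 0 < x - s ∧ 0 < x - s + 1 - θ)
    (h2 : q ≤ r → 0 < s - 1 - x + θ ∧ 0 < s - x) :
    crossFactor θ r q x s =
      crossFactor θ r q x (s - 1) * ((s - x - (1 - θ)) / (s - x)) := by
  unfold crossFactor
  split_ifs with h
  · obtain ⟨a, b⟩ := h1 h
    rw [show x - (s - 1) = x - s + 1 by ring, show x - s + 1 + 1 - θ = x - s + 1 - θ + 1 by ring,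
      Gamma_div_add_one a.ne' b.ne', mul_assoc, show s - x - (1 - θ) = -(x - s + 1 - θ) by ring,
      show s - x = -(x - s) by ring, neg_div_neg_eq]
    field_simp
  · obtain ⟨a, b⟩ := h2 (not_lt.1 h)
    rw [show s - x + θ = s - 1 - x + θ + 1 by ring, show s - x + 1 = s - 1 - x + 1 + 1 by ring,
      Gamma_div_add_one a.ne' (by linarith)]
    ring

theorem particle_sub (θ : ℝ) (lam : ℕ → ℕ → ℤ) (i j p q : ℕ) :
    particle θ lam i p - particle θ lam j q = (lam i p - lam j q : ℤ) + ((q : ℝ) - p) * θ := by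
  simp only [particle]
  push_cast
  ring

/-- The product of the factors of the `j`-th term of `R₁`, apart from the one of particle `p` in
level `j`, at the point `s`. If that particle has its pole at `s` and another denominator vanishes
there, then so does a numerator of each level; the term then has no pole at `s`, in accordance
with the value `0` that division by zero gives to this product. -/
noncomputable def upCoeff (N k : ℕ) (θ : ℝ) (ℓ : ℕ → ℕ → ℝ) (j p : ℕ) (s : ℝ) : ℝ :=
  (∏ q ∈ (upCols N j).erase p, (s - ℓ j q - upShift k θ j) / (s - ℓ j q - 1)) *
    ∏ q ∈ lowCols k j, (s - ℓ (j - 1) q - lowShift N θ j) / (s - ℓ (j - 1) q)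

/-- The product of the factors of the `j`-th term of `R₁`, apart from the one of particle `p` in
level `j - 1`, at the point `s`. -/
noncomputable def lowCoeff (N k : ℕ) (θ : ℝ) (ℓ : ℕ → ℕ → ℝ) (j p : ℕ) (s : ℝ) : ℝ :=
  (∏ q ∈ upCols N j, (s - ℓ j q - upShift k θ j) / (s - ℓ j q - 1)) *
    ∏ q ∈ (lowCols k j).erase p, (s - ℓ (j - 1) q - lowShift N θ j) / (s - ℓ (j - 1) q)

namespace IsGTArray

variable {N k M : ℕ} {lam lam' : ℕ → ℕ → ℤ} {θ : ℝ}

theorem row_gap (h : IsGTArray N k M lam) (hθ : 0 < θ) {j p q : ℕ} (hkj : k ≤ j) (hjN : j ≤ N)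
    (hp : 1 ≤ p) (hpq : p < q) (hqj : q ≤ j) :
    θ ≤ particle θ lam j p - particle θ lam j q := by
  rw [particle_sub]
  have h1 : (0 : ℝ) ≤ ((lam j p - lam j q : ℤ) : ℝ) := by
    exact_mod_cast sub_nonneg.2 (h.anti_row hkj hjN hp hpq.le hqj)
  have h2 : (p : ℝ) + 1 ≤ q := by exact_mod_cast hpq
  nlinarith

theorem link_gap_lt (h : IsGTArray N k M lam) (hθ : 0 < θ) {j p q : ℕ} (hkj : k ≤ j) (hjN : j < N)
    (hp : 1 ≤ p) (hpq : p < q) (hqj : q ≤ j + 1) :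
    θ ≤ particle θ lam j p - particle θ lam (j + 1) q := by
  rw [particle_sub]
  have h1 : (0 : ℝ) ≤ ((lam j p - lam (j + 1) q : ℤ) : ℝ) := by
    exact_mod_cast sub_nonneg.2 (h.le_of_lt hkj hjN hp hpq hqj)
  have h2 : (p : ℝ) + 1 ≤ q := by exact_mod_cast hpq
  nlinarith

theorem link_gap_le (h : IsGTArray N k M lam) (hθ : 0 < θ) {j p q : ℕ} (hkj : k ≤ j) (hjN : j < N)
    (hp : 1 ≤ p) (hpq : p ≤ q) (hqj : q ≤ j) :
    0 ≤ particle θ lam (j + 1) p - particle θ lam j q := by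
  rw [particle_sub]
  have h1 : (0 : ℝ) ≤ ((lam (j + 1) p - lam j q : ℤ) : ℝ) := by
    exact_mod_cast sub_nonneg.2 (h.le_of_le hkj hjN hp hpq hqj)
  have h2 : (p : ℝ) ≤ q := by exact_mod_cast hpq
  nlinarith

theorem pairFactor_pos {c d x : ℝ} (hx : 0 < x) (hc : 0 < x + 1 - c) (hd : 0 < x + 1 - d) :
    0 < pairFactor c d x := by
  unfold pairFactor
  have := Real.Gamma_pos_of_pos hx
  have := Real.Gamma_pos_of_pos hc
  have := Real.Gamma_pos_of_pos hd
  have := Real.Gamma_pos_of_pos (show 0 < x + 1 by linarith)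
  positivity

theorem upShift_eq (k : ℕ) (θ : ℝ) (j : ℕ) : upShift k θ j = 1 - θ ∨ upShift k θ j = θ := by
  unfold upShift; split_ifs <;> simp

theorem lowShift_eq (N : ℕ) (θ : ℝ) (j : ℕ) : lowShift N θ j = 1 - θ ∨ lowShift N θ j = θ := by
  unfold lowShift; split_ifs <;> simp

/-- All Gamma functions in the weight have positive arguments. -/
theorem gammaWeight_pos (h : IsGTArray N k M lam) (hθ : 0 < θ) :
    0 < gammaWeight N k θ (particle θ lam) := by
  unfold gammaWeight rowFactor linkFactor
  refine mul_pos (prod_pos fun j hj => prod_pos fun q hq => prod_pos fun p hp => ?_)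
    (prod_pos fun j hj => prod_pos fun r hr => prod_pos fun q hq => ?_)
  · simp only [mem_Icc, mem_Ico] at hj hq hp
    have := h.row_gap hθ hj.1 hj.2 hp.1 hp.2 hq.2
    refine pairFactor_pos (by linarith) ?_ ?_
    · rcases upShift_eq k θ j with e | e <;> rw [e] <;> linarith
    · rcases lowShift_eq N θ (j + 1) with e | e <;> rw [e] <;> linarith
  · simp only [mem_Icc, mem_Ico] at hj hr hq
    unfold crossFactor
    split_ifs with hrq
    · have := h.link_gap_lt hθ hj.1 hj.2 hr.1 hrq hq.2
      exact div_pos (Real.Gamma_pos_of_pos (by linarith)) (Real.Gamma_pos_of_pos (by linarith))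
    · have := h.link_gap_le hθ hj.1 hj.2 hq.1 (not_lt.1 hrq) hr.2
      exact div_pos (Real.Gamma_pos_of_pos (by linarith)) (Real.Gamma_pos_of_pos (by linarith))

section Move

variable {i p : ℕ} {s : ℝ}

/-- Moving a particle multiplies the interactions within its level by an explicit product. -/
theorem rowFactor_move (h : IsGTArray N k M lam) (h' : IsGTArray N k M lam') (hθ : 0 < θ)
    (hki : k ≤ i) (hiN : i ≤ N) (hp : 1 ≤ p) (hpi : p ≤ i)
    (hs : particle θ lam i p = s - 1) (hs' : particle θ lam' i p = s)
    (hne : ∀ q, q ≠ p → particle θ lam' i q = particle θ lam i q) :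
    rowFactor N k θ (particle θ lam') i = rowFactor N k θ (particle θ lam) i *
      ∏ q ∈ (Icc 1 i).erase p,
        (s - particle θ lam i q) * (s - particle θ lam i q - upShift k θ i) /
          ((s - particle θ lam i q - 1) *
            (s - particle θ lam i q - lowShift N θ (i + 1))) := by
  have hcd : upShift k θ i = lowShift N θ (i + 1) ∨ upShift k θ i + lowShift N θ (i + 1) = 1 := by
    unfold upShift lowShift; split_ifs <;> simp
  refine prod_pairs_mul (by rw [mem_Icc]; exact ⟨hp, hpi⟩) ?_ ?_ ?_
  · intro r q _ _ _ hr hq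
    rw [hne r hr, hne q hq]
  · intro q hpq hq
    rw [mem_Icc] at hq
    have := h.row_gap hθ hki hiN hp hpq hq.2
    rw [hs', hs, hne q hpq.ne']
    rw [hs] at this
    refine pairFactor_move_left (by linarith) ?_ ?_
    · rcases upShift_eq k θ i with e | e <;> rw [e] <;> linarith
    · rcases lowShift_eq N θ (i + 1) with e | e <;> rw [e] <;> linarith
  · intro q hpq hq
    rw [mem_Icc] at hq
    have := h'.row_gap hθ hki hiN hq.1 hpq hpi
    rw [hne q hpq.ne, hs'] at this
    rw [hs', hs, hne q hpq.ne]
    refine pairFactor_move_right hcd (by linarith) ?_ ?_ ?_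
    · rcases upShift_eq k θ i with e | e <;> rw [e] <;> linarith
    · rcases lowShift_eq N θ (i + 1) with e | e <;> rw [e] <;> linarith
    · rcases upShift_eq k θ i with e | e <;> rw [e] <;> linarith

theorem linkFactor_move_lower (h : IsGTArray N k M lam) (h' : IsGTArray N k M lam') (hθ : 0 < θ)
    (hki : k ≤ i) (hiN : i < N) (hp : 1 ≤ p) (hpi : p ≤ i)
    (hs : particle θ lam i p = s - 1) (hs' : particle θ lam' i p = s)
    (hne : ∀ j q, ¬(j = i ∧ q = p) → particle θ lam' j q = particle θ lam j q) :
    linkFactor θ (particle θ lam') i = linkFactor θ (particle θ lam) i *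
      ∏ q ∈ Icc 1 (i + 1),
        (s - particle θ lam (i + 1) q - 1) / (s - particle θ lam (i + 1) q - θ) := by
  have hpm : p ∈ Icc 1 i := by rw [mem_Icc]; exact ⟨hp, hpi⟩
  unfold linkFactor
  rw [← mul_prod_erase _ _ hpm, ← mul_prod_erase (Icc 1 i)
    (fun r => ∏ q ∈ Icc 1 (i + 1), crossFactor θ r q (particle θ lam i r)
      (particle θ lam (i + 1) q)) hpm, mul_right_comm, ← prod_mul_distrib]
  congr 1
  · refine prod_congr rfl fun q hq => ?_
    rw [mem_Icc] at hq
    rw [hs', hs, hne (i + 1) q (by omega)]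
    refine crossFactor_move_lower (fun hpq => ?_) (fun hpq => ?_)
    · have := h.link_gap_lt hθ hki hiN hp hpq hq.2
      rw [hs] at this
      constructor <;> linarith
    · have := h'.link_gap_le hθ hki hiN hq.1 hpq hpi
      rw [hs', hne (i + 1) q (by omega)] at this
      constructor <;> linarith
  · refine prod_congr rfl fun r hr => prod_congr rfl fun q _ => ?_
    rw [mem_erase] at hr
    rw [hne i r (by omega), hne (i + 1) q (by omega)]

theorem linkFactor_move_upper (h : IsGTArray N k M lam) (h' : IsGTArray N k M lam') (hθ : 0 < θ)
    (hki : k ≤ i) (hiN : i + 1 ≤ N) (hp : 1 ≤ p) (hpi : p ≤ i + 1)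
    (hs : particle θ lam (i + 1) p = s - 1) (hs' : particle θ lam' (i + 1) p = s)
    (hne : ∀ j q, ¬(j = i + 1 ∧ q = p) → particle θ lam' j q = particle θ lam j q) :
    linkFactor θ (particle θ lam') i = linkFactor θ (particle θ lam) i *
      ∏ r ∈ Icc 1 i,
        (s - particle θ lam i r - (1 - θ)) / (s - particle θ lam i r) := by
  have hpm : p ∈ Icc 1 (i + 1) := by rw [mem_Icc]; exact ⟨hp, hpi⟩
  unfold linkFactor
  rw [← prod_mul_distrib]
  refine prod_congr rfl fun r hr => ?_
  rw [mem_Icc] at hr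
  rw [← mul_prod_erase _ _ hpm, ← mul_prod_erase (Icc 1 (i + 1))
    (fun q => crossFactor θ r q (particle θ lam i r) (particle θ lam (i + 1) q)) hpm,
    mul_right_comm]
  congr 1
  · rw [hs', hs, hne i r (by omega)]
    refine crossFactor_move_upper (fun hpq => ?_) (fun hpq => ?_)
    · have := h'.link_gap_lt hθ hki hiN hr.1 hpq hpi
      rw [hs', hne i r (by omega)] at this
      constructor <;> linarith
    · have := h.link_gap_le hθ hki hiN hp hpq hr.2
      rw [hs] at this
      constructor <;> linarith
  · refine prod_congr rfl fun q hq => ?_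
    rw [mem_erase] at hq
    rw [hne i r (by omega), hne (i + 1) q (by omega)]

theorem upCoeff_ne_zero (h : IsGTArray N k M lam) (h' : IsGTArray N k M lam') (hθ : 0 < θ)
    (hki : k ≤ i) (hiN : i ≤ N) (hp : 1 ≤ p) (hpi : p ≤ i)
    (hs : particle θ lam i p = s - 1) (hs' : particle θ lam' i p = s)
    (hne : ∀ j q, q ≠ p → particle θ lam' j q = particle θ lam j q) :
    upCoeff N k θ (particle θ lam) i p s ≠ 0 := by
  unfold upCoeff
  refine mul_ne_zero (prod_ne_zero_iff.2 fun q hq => ?_) (prod_ne_zero_iff.2 fun q hq => ?_)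
  · rw [upCols, if_pos hiN, mem_erase, mem_Icc] at hq
    rcases lt_or_gt_of_ne hq.1 with hqp | hqp
    · have := h'.row_gap hθ hki hiN hq.2.1 hqp hpi
      rw [hs', hne i q (by omega)] at this
      refine div_ne_zero ?_ (by linarith)
      rcases upShift_eq k θ i with e | e <;> rw [e] <;> linarith
    · have := h.row_gap hθ hki hiN hp hqp hq.2.2
      rw [hs] at this
      refine div_ne_zero ?_ (by linarith)
      rcases upShift_eq k θ i with e | e <;> rw [e] <;> linarith
  · unfold lowCols at hq
    split_ifs at hq with hik
    · obtain ⟨i, rfl⟩ : ∃ i', i = i' + 1 := ⟨i - 1, by omega⟩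
      rw [lowShift, if_neg (by omega)]
      simp only [Nat.add_sub_cancel, mem_Icc] at hq ⊢
      by_cases hqp : q < p
      · have := h'.link_gap_lt hθ (by omega) hiN hq.1 hqp hpi
        rw [hs', hne i q (by omega)] at this
        exact div_ne_zero (by linarith) (by linarith)
      · have := h.link_gap_le hθ (by omega) hiN hp (not_lt.1 hqp) hq.2
        rw [hs] at this
        exact div_ne_zero (by linarith) (by linarith)
    · simp at hq

/-- Moving one particle from `s - 1` to `s`: the ratio of the weights is the ratio of the
coefficients of the poles at `s` which this particle causes before and after the move. -/
theorem gammaWeight_move (h : IsGTArray N k M lam) (h' : IsGTArray N k M lam') (hθ : 0 < θ)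
    (hki : k ≤ i) (hiN : i ≤ N) (hp : 1 ≤ p) (hpi : p ≤ i)
    (hs : particle θ lam i p = s - 1) (hs' : particle θ lam' i p = s)
    (hne : ∀ j q, ¬(j = i ∧ q = p) → particle θ lam' j q = particle θ lam j q) :
    gammaWeight N k θ (particle θ lam') * lowCoeff N k θ (particle θ lam') (i + 1) p s =
      gammaWeight N k θ (particle θ lam) * upCoeff N k θ (particle θ lam) i p s := by
  have hrow : ∏ j ∈ Icc k N, rowFactor N k θ (particle θ lam') j =
      (∏ j ∈ Icc k N, rowFactor N k θ (particle θ lam) j) *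
      ∏ q ∈ (Icc 1 i).erase p,
        (s - particle θ lam i q) * (s - particle θ lam i q - upShift k θ i) /
          ((s - particle θ lam i q - 1) *
            (s - particle θ lam i q - lowShift N θ (i + 1))) := by
    have hi : i ∈ Icc k N := by rw [mem_Icc]; exact ⟨hki, hiN⟩
    rw [← mul_prod_erase _ _ hi, ← mul_prod_erase (Icc k N)
      (fun j => rowFactor N k θ (particle θ lam) j) hi, mul_right_comm,
      h.rowFactor_move h' hθ hki hiN hp hpi hs hs' (fun q hq => hne i q (by omega))]
    congr 1
    refine prod_congr rfl fun j hj => ?_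
    rw [mem_erase] at hj
    unfold rowFactor
    refine prod_congr rfl fun q _ => prod_congr rfl fun r _ => ?_
    rw [hne j q (by omega), hne j r (by omega)]
  have hlink : ∏ j ∈ Ico k N, linkFactor θ (particle θ lam') j =
      (∏ j ∈ Ico k N, linkFactor θ (particle θ lam) j) *
      ((∏ q ∈ upCols N (i + 1),
        (s - particle θ lam (i + 1) q - 1) /
          (s - particle θ lam (i + 1) q - upShift k θ (i + 1))) *
      ∏ r ∈ lowCols k i,
        (s - particle θ lam (i - 1) r - lowShift N θ i) / (s - particle θ lam (i - 1) r)) := by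
    have hj : ∀ j ∈ Ico k N, linkFactor θ (particle θ lam') j =
        linkFactor θ (particle θ lam) j *
        ((if j = i then ∏ q ∈ upCols N (i + 1),
          (s - particle θ lam (i + 1) q - 1) /
            (s - particle θ lam (i + 1) q - upShift k θ (i + 1)) else 1) *
        (if i = j + 1 then ∏ r ∈ lowCols k i,
          (s - particle θ lam (i - 1) r - lowShift N θ i) / (s - particle θ lam (i - 1) r)
          else 1)) := by
      intro j hj
      rw [mem_Ico] at hj
      by_cases h1 : j = i
      · subst h1
        rw [if_pos rfl, if_neg (by omega), mul_one, upShift, if_neg (by omega), upCols,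
          if_pos (by omega)]
        exact h.linkFactor_move_lower h' hθ hki hj.2 hp hpi hs hs' hne
      · by_cases h2 : i = j + 1
        · subst h2
          rw [if_pos rfl, if_neg h1, one_mul, lowShift, if_neg (by omega), lowCols,
            if_pos (by omega)]
          exact h.linkFactor_move_upper h' hθ hj.1 hiN hp hpi hs hs' hne
        · rw [if_neg h1, if_neg h2, mul_one, mul_one]
          unfold linkFactor
          refine prod_congr rfl fun q _ => prod_congr rfl fun r _ => ?_
          rw [hne j q (by omega), hne (j + 1) r (by omega)]
    rw [prod_congr rfl hj, prod_mul_distrib, prod_mul_distrib]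
    congr 2
    · rw [prod_ite_eq']
      split_ifs with hi
      · rfl
      · rw [mem_Ico] at hi
        rw [upCols, if_neg (by omega), prod_empty]
    · by_cases hik : k < i
      · obtain ⟨i, rfl⟩ : ∃ i', i = i' + 1 := ⟨i - 1, by omega⟩
        simp only [Nat.add_right_cancel_iff]
        rw [prod_ite_eq, if_pos (by rw [mem_Ico]; omega)]
      · rw [lowCols, if_neg hik, prod_empty]
        refine prod_eq_one fun j hj => ?_
        rw [mem_Ico] at hj
        rw [if_neg (by omega)]
  have hlow : lowCoeff N k θ (particle θ lam') (i + 1) p s =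
      (∏ q ∈ upCols N (i + 1), (s - particle θ lam (i + 1) q - upShift k θ (i + 1)) /
        (s - particle θ lam (i + 1) q - 1)) *
      ∏ q ∈ (Icc 1 i).erase p,
        (s - particle θ lam i q - lowShift N θ (i + 1)) / (s - particle θ lam i q) := by
    unfold lowCoeff
    congr 1
    · refine prod_congr rfl fun q _ => ?_
      rw [hne (i + 1) q (by omega)]
    · rw [lowCols, if_pos (by omega), Nat.add_sub_cancel]
      refine prod_congr rfl fun q hq => ?_
      rw [mem_erase] at hq
      rw [hne i q (by omega)]
  have hup1 : (∏ q ∈ upCols N (i + 1), (s - particle θ lam (i + 1) q - 1) /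
        (s - particle θ lam (i + 1) q - upShift k θ (i + 1))) *
      (∏ q ∈ upCols N (i + 1), (s - particle θ lam (i + 1) q - upShift k θ (i + 1)) /
        (s - particle θ lam (i + 1) q - 1)) = 1 := by
    rw [← prod_mul_distrib]
    refine prod_eq_one fun q hq => ?_
    unfold upCols at hq
    split_ifs at hq with hi
    · rw [mem_Icc] at hq
      rw [upShift, if_neg (by omega)]
      have : s - particle θ lam (i + 1) q - 1 ≠ 0 ∧ s - particle θ lam (i + 1) q - θ ≠ 0 := by
        by_cases hpq : p < q
        · have := h.link_gap_lt hθ hki hi hp hpq hq.2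
          rw [hs] at this
          constructor <;> linarith
        · have := h'.link_gap_le hθ hki hi hq.1 (not_lt.1 hpq) hpi
          rw [hs', hne (i + 1) q (by omega)] at this
          constructor <;> linarith
      rw [div_mul_div_comm, mul_comm, div_self (mul_ne_zero this.2 this.1)]
    · simp at hq
  have hup2 : (∏ q ∈ (Icc 1 i).erase p,
        (s - particle θ lam i q) * (s - particle θ lam i q - upShift k θ i) /
          ((s - particle θ lam i q - 1) *
            (s - particle θ lam i q - lowShift N θ (i + 1)))) *
      ∏ q ∈ (Icc 1 i).erase p,
        (s - particle θ lam i q - lowShift N θ (i + 1)) / (s - particle θ lam i q) =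
      ∏ q ∈ (Icc 1 i).erase p,
        (s - particle θ lam i q - upShift k θ i) / (s - particle θ lam i q - 1) := by
    rw [← prod_mul_distrib]
    refine prod_congr rfl fun q hq => ?_
    rw [mem_erase, mem_Icc] at hq
    have : s - particle θ lam i q ≠ 0 ∧ s - particle θ lam i q - lowShift N θ (i + 1) ≠ 0 ∧
        s - particle θ lam i q - 1 ≠ 0 := by
      rcases lt_or_gt_of_ne hq.1 with hqp | hqp
      · have := h'.row_gap hθ hki hiN hq.2.1 hqp hpi
        rw [hs', hne i q (by omega)] at this
        refine ⟨by linarith, ?_, by linarith⟩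
        rcases lowShift_eq N θ (i + 1) with e | e <;> rw [e] <;> linarith
      · have := h.row_gap hθ hki hiN hp hqp hq.2.2
        rw [hs] at this
        refine ⟨by linarith, ?_, by linarith⟩
        rcases lowShift_eq N θ (i + 1) with e | e <;> rw [e] <;> linarith
    obtain ⟨n1, n2, n3⟩ := this
    field_simp
  rw [gammaWeight, gammaWeight, upCoeff, hrow, hlink, hlow,
    show upCols N i = Icc 1 i from if_pos hiN, ← hup2]
  linear_combination (∏ j ∈ Icc k N, rowFactor N k θ (particle θ lam) j) *
    (∏ q ∈ (Icc 1 i).erase p,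
        (s - particle θ lam i q) * (s - particle θ lam i q - upShift k θ i) /
          ((s - particle θ lam i q - 1) *
            (s - particle θ lam i q - lowShift N θ (i + 1)))) *
    (∏ j ∈ Ico k N, linkFactor θ (particle θ lam) j) *
    (∏ r ∈ lowCols k i,
        (s - particle θ lam (i - 1) r - lowShift N θ i) / (s - particle θ lam (i - 1) r)) *
    (∏ q ∈ (Icc 1 i).erase p,
        (s - particle θ lam i q - lowShift N θ (i + 1)) / (s - particle θ lam i q)) * hup1

end Move

end IsGTArray

/-! ### Moving a particle of one column simultaneously in several levels -/

/-- The array obtained by adding `δ` to the entries of column `p` in the levels `j, …, m - 1`. -/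
def shiftCol (lam : ℕ → ℕ → ℤ) (p j m : ℕ) (δ : ℤ) : ℕ → ℕ → ℤ :=
  fun i q => if q = p ∧ j ≤ i ∧ i < m then lam i q + δ else lam i q

theorem shiftCol_of_mem (lam : ℕ → ℕ → ℤ) {p j m i : ℕ} (δ : ℤ) (h1 : j ≤ i) (h2 : i < m) :
    shiftCol lam p j m δ i p = lam i p + δ := if_pos ⟨rfl, h1, h2⟩

theorem shiftCol_of_not (lam : ℕ → ℕ → ℤ) {p j m i q : ℕ} (δ : ℤ)
    (h : ¬(q = p ∧ j ≤ i ∧ i < m)) : shiftCol lam p j m δ i q = lam i q := if_neg h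

theorem shiftCol_shiftCol (lam : ℕ → ℕ → ℤ) (p j m : ℕ) (δ : ℤ) :
    shiftCol (shiftCol lam p j m δ) p j m (-δ) = lam := by
  funext i q
  unfold shiftCol
  split_ifs <;> ring

theorem particle_congr {θ : ℝ} {lam lam' : ℕ → ℕ → ℤ} {j q : ℕ} (h : lam' j q = lam j q) :
    particle θ lam' j q = particle θ lam j q := by
  simp only [particle, h]

theorem particle_eq_iff {θ : ℝ} {lam : ℕ → ℕ → ℤ} {j p : ℕ} {a : ℤ} :
    particle θ lam j p = a - p * θ ↔ lam j p = a := by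
  simp only [particle, sub_left_inj, Int.cast_inj]

theorem particle_eq_sub_one {θ : ℝ} {lam : ℕ → ℕ → ℤ} {j p : ℕ} {a : ℤ}
    (h : lam j p = a - 1) : particle θ lam j p = (a - p * θ) - 1 := by
  simp only [particle, h]
  push_cast
  ring

theorem upCoeff_congr {N k : ℕ} {θ s : ℝ} {ℓ ℓ' : ℕ → ℕ → ℝ} {j p : ℕ}
    (h1 : ∀ q, q ≠ p → ℓ j q = ℓ' j q) (h2 : ∀ q ∈ lowCols k j, ℓ (j - 1) q = ℓ' (j - 1) q) :
    upCoeff N k θ ℓ j p s = upCoeff N k θ ℓ' j p s := by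
  unfold upCoeff
  congr 1
  · exact prod_congr rfl fun q hq => by rw [h1 q (mem_erase.1 hq).1]
  · exact prod_congr rfl fun q hq => by rw [h2 q hq]

theorem lowCoeff_congr {N k : ℕ} {θ s : ℝ} {ℓ ℓ' : ℕ → ℕ → ℝ} {j p : ℕ}
    (h1 : ∀ q, ℓ j q = ℓ' j q) (h2 : ∀ q, q ≠ p → ℓ (j - 1) q = ℓ' (j - 1) q) :
    lowCoeff N k θ ℓ j p s = lowCoeff N k θ ℓ' j p s := by
  unfold lowCoeff
  congr 1
  · exact prod_congr rfl fun q hq => by rw [h1 q]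
  · exact prod_congr rfl fun q hq => by rw [h2 q (mem_erase.1 hq).1]

namespace IsGTArray

variable {N k M : ℕ} {lam : ℕ → ℕ → ℤ} {θ : ℝ} {j m p : ℕ}

theorem shiftCol_of_le (h : IsGTArray N k M lam) (h' : IsGTArray N k M (shiftCol lam p j m 1))
    {i : ℕ} (hji : j ≤ i) : IsGTArray N k M (shiftCol lam p i m 1) := by
  refine ⟨fun r q hrq => ?_, fun r q h1 h2 h3 h4 => ?_, fun r q h1 h2 h3 h4 => ?_,
    fun r q h1 h2 h3 h4 => ?_⟩
  · have := h.1 r q hrq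
    have := h'.1 r q hrq
    simp only [shiftCol] at *
    split_ifs at * <;> omega
  · have := h.2.1 r q h1 h2 h3 h4
    have := h'.2.1 r q h1 h2 h3 h4
    simp only [shiftCol] at *
    split_ifs at * <;> omega
  · have := h.2.2.1 r q h1 h2 h3 h4
    have := h'.2.2.1 r q h1 h2 h3 h4
    simp only [shiftCol] at *
    split_ifs at * <;> omega
  · have := h.2.2.2 r q h1 h2 h3 h4
    have := h'.2.2.2 r q h1 h2 h3 h4
    simp only [shiftCol] at *
    split_ifs at * <;> omega

/-- Moving the particles of column `p` in the levels `j, …, m - 1` from `s - 1` to `s`: the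
moves are performed one at a time, beginning with level `m - 1`, and the intermediate
coefficients cancel. -/
theorem gammaWeight_shiftCol (h : IsGTArray N k M lam)
    (h' : IsGTArray N k M (shiftCol lam p j m 1)) (hθ : 0 < θ) (hkj : k ≤ j) (hjm : j < m)
    (hmN : m ≤ N + 1) (hp : 1 ≤ p) (hpj : p ≤ j) {a : ℤ}
    (ha : ∀ i, j ≤ i → i < m → lam i p = a - 1) :
    gammaWeight N k θ (particle θ (shiftCol lam p j m 1)) *
        lowCoeff N k θ (particle θ (shiftCol lam p j m 1)) m p (a - p * θ) =
      gammaWeight N k θ (particle θ lam) *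
        upCoeff N k θ (particle θ lam) j p (a - p * θ) := by
  obtain ⟨n, rfl⟩ : ∃ n, m = j + 1 + n := ⟨m - (j + 1), by omega⟩
  induction n generalizing j with
  | zero =>
    refine h.gammaWeight_move h' hθ hkj (by omega) hp hpj (particle_eq_sub_one (ha j le_rfl hjm))
      (particle_eq_iff.2 ?_) (fun i q hiq => particle_congr (shiftCol_of_not _ _ (by omega)))
    rw [shiftCol_of_mem lam 1 le_rfl hjm, ha j le_rfl hjm]
    ring
  | succ n ih =>
    have hm : j + 1 + (n + 1) = j + 1 + 1 + n := by ring
    rw [hm] at h' hjm hmN ha ⊢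
    have hmid := h.shiftCol_of_le h' (show j ≤ j + 1 by omega)
    have e1 := ih (j := j + 1) (by omega) (by omega) hmid (by omega) (by omega)
      (fun i h1 h2 => ha i (by omega) h2)
    have e2 := hmid.gammaWeight_move (s := a - p * θ) h' hθ hkj (by omega) hp hpj
      (particle_eq_sub_one ((shiftCol_of_not _ _ (by omega)).trans (ha j le_rfl hjm)))
      (particle_eq_iff.2 (by
        rw [shiftCol_of_mem lam 1 le_rfl hjm, ha j le_rfl hjm]
        ring))
      (fun i q hiq => particle_congr (by
        unfold shiftCol
        split_ifs <;> first | rfl | omega))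
    have e3 : upCoeff N k θ (particle θ (shiftCol lam p (j + 1) (j + 1 + 1 + n) 1)) j p
        (a - p * θ) = upCoeff N k θ (particle θ lam) j p (a - p * θ) :=
      upCoeff_congr (fun q _ => particle_congr (shiftCol_of_not _ _ (by omega)))
        (fun q _ => particle_congr (shiftCol_of_not _ _ (by omega)))
    have e4 : lowCoeff N k θ (particle θ (shiftCol lam p (j + 1) (j + 1 + 1 + n) 1))
        (j + 1 + 1 + n) p (a - p * θ) =
        lowCoeff N k θ (particle θ (shiftCol lam p j (j + 1 + 1 + n) 1))
        (j + 1 + 1 + n) p (a - p * θ) :=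
      lowCoeff_congr (fun q => particle_congr (by
          rw [shiftCol_of_not _ _ (by omega), shiftCol_of_not _ _ (by omega)]))
        (fun q hq => particle_congr (by
          rw [shiftCol_of_not _ _ (by omega), shiftCol_of_not _ _ (by omega)]))
    -- The factors of the two omitted particles of column `p` both equal `θ`.
    have e5 : lowCoeff N k θ (particle θ (shiftCol lam p j (j + 1 + 1 + n) 1)) (j + 1) p
        (a - p * θ) = upCoeff N k θ (particle θ lam) (j + 1) p (a - p * θ) := by
      have hp1 : p ∈ upCols N (j + 1) := by
        rw [upCols, if_pos (by omega), mem_Icc]; omega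
      have hp2 : p ∈ lowCols k (j + 1) := by
        rw [lowCols, if_pos (by omega), mem_Icc]; omega
      unfold lowCoeff upCoeff
      rw [← mul_prod_erase _ _ hp1, ← mul_prod_erase (lowCols k (j + 1)) (fun q =>
        (a - p * θ - particle θ lam (j + 1 - 1) q - lowShift N θ (j + 1)) /
          (a - p * θ - particle θ lam (j + 1 - 1) q)) hp2]
      have f1 : particle θ (shiftCol lam p j (j + 1 + 1 + n) 1) (j + 1) p = a - p * θ := by
        rw [particle_eq_iff, shiftCol_of_mem lam 1 (by omega) (by omega),
          ha _ (by omega) (by omega)]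
        ring
      have f2 : particle θ lam (j + 1 - 1) p = a - p * θ - 1 :=
        particle_eq_sub_one (ha _ (by omega) (by omega))
      have f3 : ∀ i q, q ≠ p → particle θ (shiftCol lam p j (j + 1 + 1 + n) 1) i q =
          particle θ lam i q := fun i q hq => particle_congr (shiftCol_of_not _ _ (by tauto))
      rw [f1, f2, upShift, if_neg (by omega), lowShift, if_neg (by omega)]
      rw [prod_congr (g := fun q => (a - p * θ - particle θ lam (j + 1) q - θ) /
          (a - p * θ - particle θ lam (j + 1) q - 1)) (s₁ := (upCols N (j + 1)).erase p) rfl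
          (fun q hq => by rw [f3 _ q (mem_erase.1 hq).1]),
        prod_congr (g := fun q => (a - p * θ - particle θ lam (j + 1 - 1) q - (1 - θ)) /
          (a - p * θ - particle θ lam (j + 1 - 1) q)) (s₁ := (lowCols k (j + 1)).erase p) rfl
          (fun q hq => by rw [f3 _ q (mem_erase.1 hq).1])]
      ring
    have hX : upCoeff N k θ (particle θ lam) (j + 1) p (a - p * θ) ≠ 0 :=
      h.upCoeff_ne_zero h' hθ (by omega) (by omega) hp (by omega)
        (particle_eq_sub_one (ha _ (by omega) (by omega)))
        (particle_eq_iff.2 (by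
          rw [shiftCol_of_mem lam 1 (by omega) (by omega), ha _ (by omega) (by omega)]
          ring))
        (fun i q hq => particle_congr (shiftCol_of_not _ _ (by tauto)))
    have hV := (hmid.gammaWeight_pos hθ).ne'
    rw [e3, e5] at e2
    rw [e4] at e1
    apply mul_right_cancel₀ (mul_ne_zero hX hV)
    linear_combination (gammaWeight N k θ (particle θ
      (shiftCol lam p (j + 1) (j + 1 + 1 + n) 1)) *
      lowCoeff N k θ (particle θ (shiftCol lam p j (j + 1 + 1 + n) 1)) (j + 1 + 1 + n) p
        (a - p * θ)) * e2 + (gammaWeight N k θ (particle θ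
      (shiftCol lam p (j + 1) (j + 1 + 1 + n) 1)) *
      upCoeff N k θ (particle θ lam) j p (a - p * θ)) * e1

/-- The same move, for the full weight: the functions `φ_j` compensate the factors `w_i`. -/
theorem gtWeight_shiftCol (h : IsGTArray N k M lam)
    (h' : IsGTArray N k M (shiftCol lam p j m 1)) (hθ : 0 < θ) (hkN : k ≤ N) (hkj : k ≤ j)
    (hjm : j < m) (hmN : m ≤ N + 1) (hp : 1 ≤ p) (hpj : p ≤ j) {a : ℤ}
    (ha : ∀ i, j ≤ i → i < m → lam i p = a - 1) {w : ℕ → ℝ → ℂ} {c : ℕ → ℂ}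
    (hc : ∀ i, j ≤ i → i < m →
      c (i + 1) * w i (a - p * θ) = c i * w i (a - p * θ - 1)) :
    gtWeight N k θ w (particle θ (shiftCol lam p j m 1)) * (c m *
        lowCoeff N k θ (particle θ (shiftCol lam p j m 1)) m p (a - p * θ)) =
      gtWeight N k θ w (particle θ lam) * (c j *
        upCoeff N k θ (particle θ lam) j p (a - p * θ)) := by
  have hsplit : ∀ (mu : ℕ → ℕ → ℤ) (x : ℝ),
      (∀ i, j ≤ i → i < m → particle θ mu i p = x) →
      (∀ i q, ¬(q = p ∧ j ≤ i ∧ i < m) → mu i q = lam i q) →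
      ∏ i ∈ Icc k N, ∏ q ∈ Icc 1 i, w i (particle θ mu i q) =
        (∏ i ∈ Ico j m, w i x) * ∏ i ∈ Icc k N, ∏ q ∈ Icc 1 i,
          if q = p ∧ j ≤ i ∧ i < m then 1 else w i (particle θ lam i q) := by
    intro mu x hx hmu
    have : ∏ i ∈ Ico j m, w i x = ∏ i ∈ Icc k N, if j ≤ i ∧ i < m then w i x else 1 := by
      rw [← prod_filter]
      refine prod_congr ?_ fun _ _ => rfl
      ext i
      simp only [mem_Ico, mem_filter, mem_Icc]
      omega
    rw [this, ← prod_mul_distrib]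
    refine prod_congr rfl fun i hi => ?_
    by_cases hij : j ≤ i ∧ i < m
    · have hpi : p ∈ Icc 1 i := by rw [mem_Icc]; omega
      rw [if_pos hij, ← mul_prod_erase _ _ hpi, ← mul_prod_erase (Icc 1 i)
        (fun q => if q = p ∧ j ≤ i ∧ i < m then 1 else w i (particle θ lam i q)) hpi,
        hx i hij.1 hij.2, if_pos ⟨rfl, hij⟩, one_mul]
      congr 1
      refine prod_congr rfl fun q hq => ?_
      rw [mem_erase] at hq
      rw [if_neg (by tauto), particle_congr (hmu i q (by tauto))]
    · rw [if_neg hij, one_mul]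
      refine prod_congr rfl fun q hq => ?_
      rw [if_neg (by tauto), particle_congr (hmu i q (by tauto))]
  have hw : ∀ n, j ≤ n → n ≤ m →
      c n * ∏ i ∈ Ico j n, w i (a - p * θ) = c j * ∏ i ∈ Ico j n, w i (a - p * θ - 1) := by
    intro n hjn
    induction n, hjn using Nat.le_induction with
    | base => simp
    | succ n hjn ih =>
      intro hn
      rw [Finset.prod_Ico_succ_top hjn, Finset.prod_Ico_succ_top hjn]
      linear_combination (∏ i ∈ Ico j n, w i (a - p * θ)) * hc n hjn (by omega) +
        w n (a - p * θ - 1) * ih (by omega)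
  rw [gtWeight_eq hkN, gtWeight_eq hkN,
    hsplit lam (a - p * θ - 1) (fun i h1 h2 => particle_eq_sub_one (ha i h1 h2))
      (fun _ _ _ => rfl),
    hsplit (shiftCol lam p j m 1) (a - p * θ)
      (fun i h1 h2 => particle_eq_iff.2 (by
        rw [shiftCol_of_mem lam 1 h1 h2, ha i h1 h2]
        ring))
      (fun i q hiq => shiftCol_of_not _ _ hiq)]
  have e1 : ((gammaWeight N k θ (particle θ (shiftCol lam p j m 1)) : ℂ)) *
        lowCoeff N k θ (particle θ (shiftCol lam p j m 1)) m p (a - p * θ) =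
      gammaWeight N k θ (particle θ lam) *
        upCoeff N k θ (particle θ lam) j p (a - p * θ) := by
    exact_mod_cast h.gammaWeight_shiftCol h' hθ hkj hjm hmN hp hpj ha
  have e2 := hw m hjm.le le_rfl
  set R := ∏ i ∈ Icc k N, ∏ q ∈ Icc 1 i,
    if q = p ∧ j ≤ i ∧ i < m then 1 else w i (particle θ lam i q)
  linear_combination (c m * (∏ i ∈ Ico j m, w i (a - p * θ)) * R) * e1 +
    gammaWeight N k θ (particle θ lam) *
        upCoeff N k θ (particle θ lam) j p (a - p * θ) * R * e2

end IsGTArray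

/-! ### Cancellation of the residues -/

theorem upCoeff_eq_zero_of_row {N k : ℕ} {θ : ℝ} {lam : ℕ → ℕ → ℤ} {p : ℕ} {a : ℤ}
    (hkN : k ≤ N) (hp : 2 ≤ p) (hpk : p ≤ k) (h : lam k (p - 1) = a - 1) :
    upCoeff N k θ (particle θ lam) k p (a - p * θ) = 0 := by
  unfold upCoeff
  rw [prod_eq_zero (i := p - 1), zero_mul]
  · rw [upCols, if_pos hkN, mem_erase, mem_Icc]; omega
  · rw [particle_eq_sub_one h, upShift, if_pos rfl, Nat.cast_sub (by omega)]
    push_cast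
    ring

theorem upCoeff_eq_zero_of_below {N k : ℕ} {θ : ℝ} {lam : ℕ → ℕ → ℤ} {j p : ℕ} {a : ℤ}
    (hkj : k < j) (hjN : j ≤ N) (hp : 2 ≤ p) (hpj : p ≤ j) (h : lam (j - 1) (p - 1) = a - 1) :
    upCoeff N k θ (particle θ lam) j p (a - p * θ) = 0 := by
  unfold upCoeff
  rw [prod_eq_zero (i := p - 1) (s := lowCols k j), mul_zero]
  · rw [lowCols, if_pos hkj, mem_Icc]; omega
  · rw [particle_eq_sub_one h, lowShift, if_neg (by omega), Nat.cast_sub (by omega)]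
    push_cast
    ring

theorem lowCoeff_eq_zero_of_row {N k : ℕ} {θ : ℝ} {lam : ℕ → ℕ → ℤ} {p : ℕ} {a : ℤ}
    (hkN : k ≤ N) (hpN : p < N) (h : lam N (p + 1) = a) :
    lowCoeff N k θ (particle θ lam) (N + 1) p (a - p * θ) = 0 := by
  unfold lowCoeff
  rw [prod_eq_zero (i := p + 1) (s := (lowCols k (N + 1)).erase p), mul_zero]
  · rw [lowCols, if_pos (by omega), mem_erase, mem_Icc]; omega
  · rw [Nat.add_sub_cancel, particle_eq_iff.2 h, lowShift, if_pos rfl]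
    push_cast
    ring

theorem lowCoeff_eq_zero_of_above {N k : ℕ} {θ : ℝ} {lam : ℕ → ℕ → ℤ} {m p : ℕ} {a : ℤ}
    (hkm : k < m) (hmN : m ≤ N) (hpm : p < m) (h : lam m (p + 1) = a) :
    lowCoeff N k θ (particle θ lam) m p (a - p * θ) = 0 := by
  unfold lowCoeff
  rw [prod_eq_zero (i := p + 1), zero_mul]
  · rw [upCols, if_pos hmN, mem_Icc]; omega
  · rw [particle_eq_iff.2 h, upShift, if_neg (by omega)]
    push_cast
    ring

/-- The entries of column `p` in the levels `j, …, m - 1` are `a - 1`, and level `m` is the first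
one above where the column reaches `a`. -/
def IsLowBlock (N p : ℕ) (a : ℤ) (j m : ℕ) (lam : ℕ → ℕ → ℤ) : Prop :=
  (∀ i, j ≤ i → i < m → lam i p = a - 1) ∧ (m ≤ N → a ≤ lam m p)

/-- The entries of column `p` in the levels `j, …, m - 1` are `a`, and level `j` is the first one
where the column reaches `a`. -/
def IsHighBlock (k p : ℕ) (a : ℤ) (j m : ℕ) (lam : ℕ → ℕ → ℤ) : Prop :=
  (∀ i, j ≤ i → i < m → lam i p = a) ∧ (k < j → p < j → lam (j - 1) p ≤ a - 1)

namespace IsGTArray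

variable {N k M : ℕ} {lam : ℕ → ℕ → ℤ} {θ : ℝ} {j m p : ℕ} {a : ℤ}

theorem isGTArray_raise (h : IsGTArray N k M lam) (hkj : k ≤ j) (hjm : j < m)
    (hmN : m ≤ N + 1) (hp : 1 ≤ p) (hpj : p ≤ j) (ha0 : 1 ≤ a) (haM : a ≤ M)
    (hb : IsLowBlock N p a j m lam)
    (hne : upCoeff N k θ (particle θ lam) j p (a - p * θ) ≠ 0) :
    IsGTArray N k M (shiftCol lam p j m 1) := by
  -- The neighbouring column `p - 1` has reached `a` already, since a factor of the coefficient
  -- vanishes otherwise.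
  have hleft : ∀ i, j ≤ i + 1 → i < m → k ≤ i → 2 ≤ p → p ≤ i + 1 → a ≤ lam i (p - 1) := by
    intro i hi him hki hp2 hpi
    by_cases hkj' : k < j
    · have h1 : lam (j - 1) (p - 1) ≠ a - 1 := fun e =>
        hne (upCoeff_eq_zero_of_below hkj' (by omega) hp2 hpj e)
      have h2 : lam j p ≤ lam (j - 1) (p - 1) := by
        obtain ⟨j, rfl⟩ : ∃ j', j = j' + 1 := ⟨j - 1, by omega⟩
        exact h.le_of_lt (by omega) (by omega) (by omega) (by omega) (by omega)
      have h3 := hb.1 j le_rfl hjm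
      have h4 : lam (j - 1) (p - 1) ≤ lam i (p - 1) :=
        h.mono_col (by omega) (by omega) (by omega) (by omega) (by omega)
      omega
    · have : j = k := by omega
      subst this
      have h1 : lam j (p - 1) ≠ a - 1 := fun e =>
        hne (upCoeff_eq_zero_of_row (by omega) hp2 hpj e)
      have h2 : lam j p ≤ lam j (p - 1) :=
        h.anti_row (by omega) (by omega) (by omega) (by omega) (by omega)
      have h3 := hb.1 j le_rfl hjm
      have h4 : lam j (p - 1) ≤ lam i (p - 1) :=
        h.mono_col (by omega) (by omega) (by omega) (by omega) (by omega)
      omega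
  refine ⟨fun r q hrq => ?_, fun r q h1 h2 h3 h4 => ?_, fun r q h1 h2 h3 h4 => ?_,
    fun r q h1 h2 h3 h4 => ?_⟩
  · rw [shiftCol_of_not _ _ (by omega)]
    exact h.1 r q hrq
  · have h5 := h.2.1 r q h1 h2 h3 h4
    have h6 := hb.1 r
    simp only [shiftCol]
    split_ifs with h7
    · have := h6 h7.2.1 h7.2.2
      rw [h7.1]
      omega
    · exact h5
  · have h5 := h.2.2.1 r q h1 h2 h3 h4
    have h6 := hb.1 r
    simp only [shiftCol]
    split_ifs with h7 h8 h8
    · omega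
    · have := hleft r (by omega) (by omega) h1 (by omega) (by omega)
      have := h6 h7.2.1 h7.2.2
      rw [h7.1]
      have : p - 1 = q := by omega
      rw [← this]
      omega
    · omega
    · exact h5
  · have h5 := h.2.2.2 r q h1 h2 h3 h4
    have h6 := hb.1 r
    have h6' := hb.1 (r + 1)
    have h9 : r + 1 = m → a ≤ lam (r + 1) p := fun e => e ▸ hb.2 (by omega)
    constructor
    · simp only [shiftCol]
      split_ifs with h7 h8 h8
      · omega
      · have := h6 h7.2.1 h7.2.2
        have := h9 (by omega)
        rw [h7.1]
        omega
      · omega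
      · omega
    · simp only [shiftCol]
      split_ifs with h7 h8 h8
      · omega
      · have := hleft r (by omega) (by omega) h1 (by omega) (by omega)
        have := h6' h7.2.1 h7.2.2
        rw [h7.1]
        have : p - 1 = q := by omega
        rw [← this]
        omega
      · omega
      · omega

theorem isGTArray_lower (h : IsGTArray N k M lam) (hkj : k ≤ j) (hjm : j < m)
    (hmN : m ≤ N + 1) (hp : 1 ≤ p) (hpj : p ≤ j) (ha0 : 1 ≤ a)
    (hb : IsHighBlock k p a j m lam)
    (hne : lowCoeff N k θ (particle θ lam) m p (a - p * θ) ≠ 0) :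
    IsGTArray N k M (shiftCol lam p j m (-1)) := by
  -- The neighbouring column `p + 1` has not reached `a` yet, since a factor of the coefficient
  -- vanishes otherwise.
  have hright : ∀ i, j ≤ i → i ≤ m → i ≤ N → p + 1 ≤ i → lam i (p + 1) ≤ a - 1 := by
    intro i hi him hiN hpi
    by_cases hmN' : m ≤ N
    · have h1 : lam m (p + 1) ≠ a := fun e =>
        hne (lowCoeff_eq_zero_of_above (by omega) (by omega) (by omega) e)
      have h2 : lam m (p + 1) ≤ lam (m - 1) p := by
        obtain ⟨m, rfl⟩ : ∃ m', m = m' + 1 := ⟨m - 1, by omega⟩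
        exact h.le_of_lt (by omega) (by omega) (by omega) (by omega) (by omega)
      have h3 := hb.1 (m - 1) (by omega) (by omega)
      have h4 : lam i (p + 1) ≤ lam m (p + 1) :=
        h.mono_col (by omega) (by omega) (by omega) (by omega) (by omega)
      omega
    · have : m = N + 1 := by omega
      subst this
      have h1 : lam N (p + 1) ≠ a := fun e =>
        hne (lowCoeff_eq_zero_of_row (by omega) (by omega) e)
      have h2 : lam N (p + 1) ≤ lam N p :=
        h.anti_row (by omega) (by omega) (by omega) (by omega) (by omega)
      have h3 := hb.1 N (by omega) (by omega)
      have h4 : lam i (p + 1) ≤ lam N (p + 1) :=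
        h.mono_col (by omega) (by omega) (by omega) (by omega) (by omega)
      omega
  refine ⟨fun r q hrq => ?_, fun r q h1 h2 h3 h4 => ?_, fun r q h1 h2 h3 h4 => ?_,
    fun r q h1 h2 h3 h4 => ?_⟩
  · rw [shiftCol_of_not _ _ (by omega)]
    exact h.1 r q hrq
  · have h5 := h.2.1 r q h1 h2 h3 h4
    have h6 := hb.1 r
    simp only [shiftCol]
    split_ifs with h7
    · have := h6 h7.2.1 h7.2.2
      rw [h7.1] at h5 ⊢
      omega
    · exact h5
  · have h5 := h.2.2.1 r q h1 h2 h3 h4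
    have h6 := hb.1 r
    simp only [shiftCol]
    split_ifs with h7 h8 h8
    · omega
    · omega
    · have := hright r (by omega) (by omega) h2 (by omega)
      have := h6 h8.2.1 h8.2.2
      rw [h8.1]
      omega
    · exact h5
  · have h5 := h.2.2.2 r q h1 h2 h3 h4
    have h6 := hb.1 r
    have h6' := hb.1 (r + 1)
    have h9 : r + 1 = j → p ≤ r → lam r p ≤ a - 1 := fun e e' => by
      have := hb.2 (by omega) (by omega)
      rwa [← e, Nat.add_sub_cancel] at this
    constructor
    · simp only [shiftCol]
      split_ifs with h7 h8 h8
      · omega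
      · omega
      · have := h6' h8.2.1 h8.2.2
        have := h9 (by omega) (by omega)
        rw [h8.1]
        omega
      · omega
    · simp only [shiftCol]
      split_ifs with h7 h8 h8
      · omega
      · omega
      · have := hright (r + 1) (by omega) (by omega) (by omega) (by omega)
        have := h6 h8.2.1 h8.2.2
        rw [h8.1]
        omega
      · omega

end IsGTArray

open Classical in
/-- The move of column `p` between the levels `j` and `m` matches the residues at
`s = a - pθ` caused by particles of column `p` in level `j` of the `j`-th term with those caused
by level `m - 1` in the `m`-th term. Where a move would leave the state space, the residue is
zero. -/
theorem sum_block {N k M : ℕ} {θ : ℝ} (hθ : 0 < θ) (hkN : k ≤ N) {w : ℕ → ℝ → ℂ} {c : ℕ → ℂ}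
    {j m p : ℕ} {a : ℤ} (hkj : k ≤ j) (hjm : j < m) (hmN : m ≤ N + 1) (hp : 1 ≤ p) (hpj : p ≤ j)
    (ha0 : 1 ≤ a) (haM : a ≤ M)
    (hc : ∀ i, j ≤ i → i < m →
      c (i + 1) * w i (a - p * θ) = c i * w i (a - p * θ - 1)) :
    ∑ lam ∈ gtArrays N k M with IsLowBlock N p a j m lam,
        gtWeight N k θ w (particle θ lam) *
          (c j * upCoeff N k θ (particle θ lam) j p (a - p * θ)) =
      ∑ lam ∈ gtArrays N k M with IsHighBlock k p a j m lam,
        gtWeight N k θ w (particle θ lam) *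
          (c m * lowCoeff N k θ (particle θ lam) m p (a - p * θ)) := by
  have hU : ∀ lam ∈ (gtArrays N k M).filter (IsLowBlock N p a j m),
      gtWeight N k θ w (particle θ lam) *
          (c j * (upCoeff N k θ (particle θ lam) j p (a - p * θ) : ℂ)) ≠ 0 →
      IsGTArray N k M lam ∧ IsLowBlock N p a j m lam ∧
        IsGTArray N k M (shiftCol lam p j m 1) := by
    intro lam hl hne
    rw [mem_filter, mem_gtArrays] at hl
    refine ⟨hl.1, hl.2, hl.1.isGTArray_raise (θ := θ) hkj hjm hmN hp hpj ha0 haM hl.2 ?_⟩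
    intro e
    rw [e] at hne
    simp at hne
  refine sum_bij_ne_zero (fun lam _ _ => shiftCol lam p j m 1) ?_ ?_ ?_ ?_
  · intro lam hl hne
    obtain ⟨h, hb, h'⟩ := hU lam hl hne
    rw [mem_filter, mem_gtArrays]
    refine ⟨h', fun i h1 h2 => ?_, fun h1 h2 => ?_⟩
    · rw [shiftCol_of_mem lam 1 h1 h2, hb.1 i h1 h2]
      ring
    · rw [shiftCol_of_not _ _ (by omega), ← hb.1 j le_rfl hjm]
      exact h.mono_col (by omega) (by omega) (by omega) hp (by omega)
  · intro lam _ _ mu _ _ e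
    rw [← shiftCol_shiftCol lam p j m 1, ← shiftCol_shiftCol mu p j m 1, e]
  · intro mu hm hne
    rw [mem_filter, mem_gtArrays] at hm
    have h' : IsGTArray N k M (shiftCol mu p j m (-1)) := by
      refine hm.1.isGTArray_lower (θ := θ) hkj hjm hmN hp hpj ha0 hm.2 ?_
      intro e
      rw [e] at hne
      simp at hne
    have hb : IsLowBlock N p a j m (shiftCol mu p j m (-1)) := by
      refine ⟨fun i h1 h2 => ?_, fun h1 => ?_⟩
      · rw [shiftCol_of_mem mu _ h1 h2, hm.2.1 i h1 h2]
        ring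
      · rw [shiftCol_of_not _ _ (by omega), ← hm.2.1 j le_rfl hjm]
        exact hm.1.mono_col (by omega) (by omega) (by omega) hp (by omega)
    have e : shiftCol (shiftCol mu p j m (-1)) p j m 1 = mu := by
      simpa using shiftCol_shiftCol mu p j m (-1)
    refine ⟨shiftCol mu p j m (-1), by rw [mem_filter, mem_gtArrays]; exact ⟨h', hb⟩, ?_, e⟩
    rw [← h'.gtWeight_shiftCol (by rw [e]; exact hm.1) hθ hkN hkj hjm hmN hp hpj hb.1 hc, e]
    exact hne
  · intro lam hl hne
    obtain ⟨h, hb, h'⟩ := hU lam hl hne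
    exact (h.gtWeight_shiftCol h' hθ hkN hkj hjm hmN hp hpj hb.1 hc).symm

open Classical in
/-- An entry `a - 1` of column `p` begins exactly one block. -/
theorem sum_isLowBlock {N k M : ℕ} {lam : ℕ → ℕ → ℤ} {j p : ℕ} {a : ℤ}
    (h : IsGTArray N k M lam) (hkj : k ≤ j) (hjN : j ≤ N) (hp : 1 ≤ p) (hpj : p ≤ j) (x : ℂ) :
    (∑ m ∈ Icc (j + 1) (N + 1), if IsLowBlock N p a j m lam then x else 0) =
      if lam j p = a - 1 then x else 0 := by
  split_ifs with hl
  · have hex : ∃ m, j < m ∧ (m ≤ N → a ≤ lam m p) := ⟨N + 1, by omega, fun h => by omega⟩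
    have hmin := fun n (hn : n < Nat.find hex) => Nat.find_min hex hn
    have hspec := Nat.find_spec hex
    have hle : Nat.find hex ≤ N + 1 := Nat.find_min' hex ⟨by omega, fun h => by omega⟩
    generalize Nat.find hex = m at hmin hspec hle
    have hiff : ∀ m' ∈ Icc (j + 1) (N + 1), IsLowBlock N p a j m' lam ↔ m' = m := by
      intro m' hm'
      rw [mem_Icc] at hm'
      constructor
      · intro hb
        rcases lt_trichotomy m' m with hlt | heq | hgt
        · exact absurd ⟨by omega, hb.2⟩ (hmin m' hlt)
        · exact heq
        · have h1 := hspec.2 (by omega)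
          have h2 := hb.1 m (by omega) hgt
          omega
      · rintro rfl
        refine ⟨fun i h1 h2 => ?_, hspec.2⟩
        have h3 : lam j p ≤ lam i p := h.mono_col hkj h1 (by omega) hp hpj
        rcases h1.eq_or_lt with rfl | h1
        · exact hl
        · have h4 := hmin i h2
          push Not at h4
          have := h4 h1
          omega
    rw [sum_congr rfl (fun m' hm' => if_congr (hiff m' hm') rfl rfl), sum_ite_eq',
      if_pos (by rw [mem_Icc]; omega)]
  · refine sum_eq_zero fun m hm => if_neg fun hb => hl ?_
    rw [mem_Icc] at hm
    exact hb.1 j le_rfl (by omega)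

open Classical in
/-- An entry `a` of column `p` ends exactly one block. -/
theorem sum_isHighBlock {N k M : ℕ} {lam : ℕ → ℕ → ℤ} {i p : ℕ} {a : ℤ}
    (h : IsGTArray N k M lam) (hki : k ≤ i) (hiN : i ≤ N) (hp : 1 ≤ p) (hpi : p ≤ i) (x : ℂ) :
    (∑ j ∈ Icc (max k p) i, if IsHighBlock k p a j (i + 1) lam then x else 0) =
      if lam i p = a then x else 0 := by
  split_ifs with hl
  · have hex : ∃ j, max k p ≤ j ∧ lam j p = a := ⟨i, by omega, hl⟩
    have hmin := fun n (hn : n < Nat.find hex) => Nat.find_min hex hn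
    have hspec := Nat.find_spec hex
    have hle : Nat.find hex ≤ i := Nat.find_min' hex ⟨by omega, hl⟩
    generalize Nat.find hex = j at hmin hspec hle
    have hiff : ∀ j' ∈ Icc (max k p) i, IsHighBlock k p a j' (i + 1) lam ↔ j' = j := by
      intro j' hj'
      rw [mem_Icc] at hj'
      constructor
      · intro hb
        rcases lt_trichotomy j' j with hlt | heq | hgt
        · exact absurd ⟨hj'.1, hb.1 j' le_rfl (by omega)⟩ (hmin j' hlt)
        · exact heq
        · have h1 := hb.2 (by omega) (by omega)
          have h2 : lam j p ≤ lam (j' - 1) p :=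
            h.mono_col (by omega) (by omega) (by omega) hp (by omega)
          omega
      · rintro rfl
        refine ⟨fun r h1 h2 => ?_, fun h1 h2 => ?_⟩
        · have h3 : lam j' p ≤ lam r p := h.mono_col (by omega) h1 (by omega) hp (by omega)
          have h4 : lam r p ≤ lam i p :=
            h.mono_col (by omega) (by omega) (by omega) hp (by omega)
          omega
        · have h3 := hmin (j' - 1) (by omega)
          push Not at h3
          have h4 := h3 (by omega)
          have h5 : lam (j' - 1) p ≤ lam j' p :=
            h.mono_col (by omega) (by omega) (by omega) hp (by omega)
          omega
    rw [sum_congr rfl (fun m' hm' => if_congr (hiff m' hm') rfl rfl), sum_ite_eq',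
      if_pos (by rw [mem_Icc]; omega)]
  · refine sum_eq_zero fun j hj => if_neg fun hb => hl ?_
    rw [mem_Icc] at hj
    exact hb.1 i (by omega) (by omega)

/-- The residues at `s`, weighted and summed over the state space, which are caused by particles
of column `p` as upper-level particles (up to the factor `θ`). -/
noncomputable def upResidue (N k M : ℕ) (θ : ℝ) (w : ℕ → ℝ → ℂ) (c : ℕ → ℂ) (p : ℕ) (s : ℝ) : ℂ :=
  ∑ j ∈ Icc (max k p) N, ∑ lam ∈ gtArrays N k M,
    if particle θ lam j p = s - 1 then
      gtWeight N k θ w (particle θ lam) * (c j * upCoeff N k θ (particle θ lam) j p s) else 0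

/-- The residues at `s`, weighted and summed over the state space, which are caused by particles
of column `p` as lower-level particles (up to the factor `-θ`). -/
noncomputable def lowResidue (N k M : ℕ) (θ : ℝ) (w : ℕ → ℝ → ℂ) (c : ℕ → ℂ) (p : ℕ) (s : ℝ) :
    ℂ :=
  ∑ i ∈ Icc (max k p) N, ∑ lam ∈ gtArrays N k M,
    if particle θ lam i p = s then
      gtWeight N k θ w (particle θ lam) *
        (c (i + 1) * lowCoeff N k θ (particle θ lam) (i + 1) p s) else 0

/-- In the interior all residues caused by one column cancel. -/
theorem upResidue_eq_lowResidue {N k M : ℕ} {θ : ℝ} (hθ : 0 < θ) (hkN : k ≤ N)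
    {w : ℕ → ℝ → ℂ} {c : ℕ → ℂ} {p : ℕ} {a : ℤ} (hp : 1 ≤ p) (ha0 : 1 ≤ a) (haM : a ≤ M)
    (hc : ∀ i, k ≤ i → p ≤ i → i ≤ N →
      c (i + 1) * w i (a - p * θ) = c i * w i (a - p * θ - 1)) :
    upResidue N k M θ w c p (a - p * θ) = lowResidue N k M θ w c p (a - p * θ) := by
  classical
  have hU : upResidue N k M θ w c p (a - p * θ) =
      ∑ j ∈ Icc (max k p) N, ∑ m ∈ Icc (j + 1) (N + 1),
        ∑ lam ∈ gtArrays N k M with IsLowBlock N p a j m lam,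
          gtWeight N k θ w (particle θ lam) *
            (c j * upCoeff N k θ (particle θ lam) j p (a - p * θ)) := by
    unfold upResidue
    refine sum_congr rfl fun j hj => ?_
    rw [mem_Icc] at hj
    simp_rw [sum_filter]
    rw [sum_comm]
    refine sum_congr rfl fun lam hl => ?_
    rw [mem_gtArrays] at hl
    rw [sum_isLowBlock hl (by omega) hj.2 hp (by omega)]
    refine if_congr ?_ rfl rfl
    rw [← particle_eq_iff (θ := θ)]
    push_cast
    rw [sub_right_comm]
  have hL : lowResidue N k M θ w c p (a - p * θ) =
      ∑ i ∈ Icc (max k p) N, ∑ j ∈ Icc (max k p) i,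
        ∑ lam ∈ gtArrays N k M with IsHighBlock k p a j (i + 1) lam,
          gtWeight N k θ w (particle θ lam) *
            (c (i + 1) * lowCoeff N k θ (particle θ lam) (i + 1) p (a - p * θ)) := by
    unfold lowResidue
    refine sum_congr rfl fun i hi => ?_
    rw [mem_Icc] at hi
    simp_rw [sum_filter]
    rw [sum_comm]
    refine sum_congr rfl fun lam hl => ?_
    rw [mem_gtArrays] at hl
    rw [sum_isHighBlock hl (by omega) hi.2 hp (by omega)]
    exact if_congr particle_eq_iff rfl rfl
  rw [hU, hL]
  have hshift : ∀ (j : ℕ) (F : ℕ → ℂ),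
      ∑ m ∈ Icc (j + 1) (N + 1), F m = ∑ i ∈ Icc j N, F (i + 1) := by
    intro j F
    rw [← Finset.Ico_add_one_right_eq_Icc, ← Finset.Ico_add_one_right_eq_Icc,
      Finset.sum_Ico_add']
  simp_rw [hshift]
  rw [sum_comm' (t' := Icc (max k p) N) (s' := fun i => Icc (max k p) i)
    (by intro x y; simp only [mem_Icc]; omega)]
  refine sum_congr rfl fun i hi => sum_congr rfl fun j hj => ?_
  rw [mem_Icc] at hi hj
  exact sum_block hθ hkN (by omega) (by omega) (by omega) hp (by omega) ha0 haM
    (fun r h1 h2 => hc r (by omega) (by omega) (by omega))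

/-- At the boundary of the state space, only the first column at its largest position and the last
column at its smallest position leave a residue. -/
theorem upResidue_sub_lowResidue {N k M : ℕ} {θ : ℝ} (hθ : 0 < θ) (hkN : k ≤ N)
    {w : ℕ → ℝ → ℂ} {c : ℕ → ℂ} {p : ℕ} (hp : 1 ≤ p) (hpN : p ≤ N) (s : ℝ)
    (hc : ∀ i, k ≤ i → i ≤ N → s ∈ Set.Icc (1 - i * θ) (M - θ) →
      c (i + 1) * w i s = c i * w i (s - 1)) :
    upResidue N k M θ w c p s - lowResidue N k M θ w c p s =
      (if p = 1 then if s = M + 1 - θ then upResidue N k M θ w c p s else 0 else 0) -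
        if p = N then if s = -(N * θ) then lowResidue N k M θ w c p s else 0 else 0 := by
  have hup0 : (∀ lam j, IsGTArray N k M lam → max k p ≤ j → j ≤ N →
      particle θ lam j p = s - 1 → upCoeff N k θ (particle θ lam) j p s = 0) →
      upResidue N k M θ w c p s = 0 := by
    intro hz
    refine sum_eq_zero fun j hj => sum_eq_zero fun lam hl => ?_
    rw [mem_Icc] at hj
    split_ifs with h
    · rw [hz lam j (mem_gtArrays.1 hl) hj.1 hj.2 h]
      simp
    · rfl
  have hlow0 : (∀ lam i, IsGTArray N k M lam → max k p ≤ i → i ≤ N →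
      particle θ lam i p = s → lowCoeff N k θ (particle θ lam) (i + 1) p s = 0) →
      lowResidue N k M θ w c p s = 0 := by
    intro hz
    refine sum_eq_zero fun j hj => sum_eq_zero fun lam hl => ?_
    rw [mem_Icc] at hj
    split_ifs with h
    · rw [hz lam j (mem_gtArrays.1 hl) hj.1 hj.2 h]
      simp
    · rfl
  by_cases hs : ∃ a : ℤ, s = a - p * θ
  · obtain ⟨a, rfl⟩ := hs
    have hupeq : ∀ lam j, particle θ lam j p = a - p * θ - 1 ↔ lam j p = a - 1 := by
      intro lam j
      rw [← particle_eq_iff (θ := θ)]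
      push_cast
      rw [sub_right_comm]
    have hM : p = 1 → ((a : ℝ) - p * θ = M + 1 - θ ↔ a = M + 1) := by
      rintro rfl
      rw [Nat.cast_one, one_mul, sub_left_inj]
      exact_mod_cast Iff.rfl
    have h0 : p = N → ((a : ℝ) - p * θ = -(N * θ) ↔ a = 0) := by
      rintro rfl
      rw [sub_eq_neg_self]
      exact_mod_cast Iff.rfl
    rcases lt_trichotomy a 0 with ha | ha | ha
    · rw [hup0, hlow0]
      · simp
      · intro lam i h h1 h2 h3
        have := h.2.1 i p (by omega) h2 hp (by omega)
        rw [particle_eq_iff] at h3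
        omega
      · intro lam i h h1 h2 h3
        have := h.2.1 i p (by omega) h2 hp (by omega)
        rw [hupeq] at h3
        omega
    · have hu := hup0 (by
        intro lam i h h1 h2 h3
        have := h.2.1 i p (by omega) h2 hp (by omega)
        rw [hupeq] at h3
        omega)
      rw [hu]
      by_cases hpN' : p = N
      · rw [if_pos hpN', if_pos ((h0 hpN').2 ha)]
        simp
      · rw [if_neg hpN', hlow0]
        · simp
        · intro lam i h h1 h2 h3
          rw [particle_eq_iff] at h3
          rcases h2.eq_or_lt with rfl | h2
          · apply lowCoeff_eq_zero_of_row hkN (by omega)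
            have h4 := h.2.1 i (p + 1) (by omega) le_rfl (by omega) (by omega)
            have h5 := h.2.2.1 i p (by omega) le_rfl hp (by omega)
            omega
          · apply lowCoeff_eq_zero_of_above (m := i + 1) (by omega) h2 (by omega)
            have h4 := h.2.1 (i + 1) (p + 1) (by omega) h2 (by omega) (by omega)
            have h5 := h.2.2.2 i p (by omega) h2 hp (by omega)
            omega
    · rcases lt_trichotomy a (M + 1) with haM | haM | haM
      · have hnp : ¬(p = 1 ∧ (a : ℝ) - p * θ = M + 1 - θ) := by
          rintro ⟨h1, h2⟩
          rw [hM h1] at h2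
          omega
        have hnN : ¬(p = N ∧ (a : ℝ) - p * θ = -(N * θ)) := by
          rintro ⟨h1, h2⟩
          rw [h0 h1] at h2
          omega
        rw [← ite_and, ← ite_and, if_neg hnp, if_neg hnN,
          upResidue_eq_lowResidue hθ hkN hp (by omega) (by omega), sub_self, sub_self]
        intro i h1 h2 h3
        refine hc i h1 h3 ⟨?_, ?_⟩
        · have h4 : (1 : ℝ) ≤ a := by exact_mod_cast ha
          have h5 : (p : ℝ) ≤ i := by exact_mod_cast h2
          nlinarith
        · have h4 : (a : ℝ) ≤ M := by exact_mod_cast (show a ≤ M by omega)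
          have h5 : (1 : ℝ) ≤ p := by exact_mod_cast hp
          nlinarith
      · have hl := hlow0 (by
          intro lam i h h1 h2 h3
          have := h.2.1 i p (by omega) h2 hp (by omega)
          rw [particle_eq_iff] at h3
          omega)
        rw [hl]
        by_cases hp1 : p = 1
        · rw [if_pos hp1, if_pos ((hM hp1).2 haM)]
          simp
        · rw [if_neg hp1, hup0]
          · simp
          · intro lam i h h1 h2 h3
            rw [hupeq] at h3
            by_cases hik : i = k
            · subst hik
              apply upCoeff_eq_zero_of_row hkN (by omega) (by omega)
              have h4 := h.2.1 i (p - 1) (by omega) h2 (by omega) (by omega)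
              have h5 : lam i p ≤ lam i (p - 1) :=
                h.anti_row le_rfl h2 (by omega) (by omega) (by omega)
              omega
            · apply upCoeff_eq_zero_of_below (by omega) h2 (by omega) (by omega)
              have h4 := h.2.1 (i - 1) (p - 1) (by omega) (by omega) (by omega) (by omega)
              have h5 : lam i p ≤ lam (i - 1) (p - 1) := by
                obtain ⟨i, rfl⟩ : ∃ i', i = i' + 1 := ⟨i - 1, by omega⟩
                exact h.le_of_lt (by omega) (by omega) (by omega) (by omega) (by omega)
              omega
      · rw [hup0, hlow0]
        · simp
        · intro lam i h h1 h2 h3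
          have := h.2.1 i p (by omega) h2 hp (by omega)
          rw [particle_eq_iff] at h3
          omega
        · intro lam i h h1 h2 h3
          have := h.2.1 i p (by omega) h2 hp (by omega)
          rw [hupeq] at h3
          omega
  · rw [hup0, hlow0]
    · simp
    · intro lam i h h1 h2 h3
      exact absurd ⟨lam i p, h3.symm⟩ hs
    · intro lam i h h1 h2 h3
      refine absurd ⟨lam i p + 1, ?_⟩ hs
      push_cast
      unfold particle at h3
      linarith

/-- The sum of all residues at `s` is the one at the boundary. -/
theorem sum_residues {N k M : ℕ} {θ : ℝ} (hθ : 0 < θ) (hk : 1 ≤ k) (hkN : k ≤ N)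
    {w : ℕ → ℝ → ℂ} {c : ℕ → ℂ} (s : ℝ)
    (hc : ∀ i, k ≤ i → i ≤ N → s ∈ Set.Icc (1 - i * θ) (M - θ) →
      c (i + 1) * w i s = c i * w i (s - 1)) :
    ∑ lam ∈ gtArrays N k M, gtWeight N k θ w (particle θ lam) * ∑ j ∈ Icc k (N + 1), c j *
      ((∑ p ∈ upCols N j,
          if particle θ lam j p = s - 1 then
            (upCoeff N k θ (particle θ lam) j p s : ℂ) else 0) -
        ∑ p ∈ lowCols k j,
          if particle θ lam (j - 1) p = s then
            (lowCoeff N k θ (particle θ lam) j p s : ℂ) else 0) =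
      (if s = M + 1 - θ then upResidue N k M θ w c 1 s else 0) -
        if s = -(N * θ) then lowResidue N k M θ w c N s else 0 := by
  have hU : ∑ lam ∈ gtArrays N k M, ∑ j ∈ Icc k (N + 1), ∑ p ∈ upCols N j,
      (if particle θ lam j p = s - 1 then gtWeight N k θ w (particle θ lam) *
        (c j * upCoeff N k θ (particle θ lam) j p s) else 0) =
      ∑ p ∈ Icc 1 N, upResidue N k M θ w c p s := by
    unfold upResidue
    rw [sum_comm' (t' := Icc k (N + 1)) (s' := fun _ => gtArrays N k M) (by simp)]
    rw [sum_comm' (s := Icc 1 N) (t' := Icc k N) (s' := fun j => Icc 1 j)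
      (by intro x y; simp only [mem_Icc]; omega)]
    rw [← Finset.Ico_add_one_right_eq_Icc k (N + 1), Finset.sum_Ico_succ_top (by omega),
      Finset.Ico_add_one_right_eq_Icc]
    simp only [upCols, if_neg (show ¬(N + 1 ≤ N) by omega), sum_empty, sum_const_zero, add_zero]
    refine sum_congr rfl fun j hj => ?_
    rw [mem_Icc] at hj
    rw [if_pos hj.2, sum_comm]
  have hL : ∑ lam ∈ gtArrays N k M, ∑ j ∈ Icc k (N + 1), ∑ p ∈ lowCols k j,
      (if particle θ lam (j - 1) p = s then gtWeight N k θ w (particle θ lam) *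
        (c j * lowCoeff N k θ (particle θ lam) j p s) else 0) =
      ∑ p ∈ Icc 1 N, lowResidue N k M θ w c p s := by
    unfold lowResidue
    rw [sum_comm' (t' := Icc k (N + 1)) (s' := fun _ => gtArrays N k M) (by simp)]
    rw [sum_comm' (s := Icc 1 N) (t' := Icc k N) (s' := fun j => Icc 1 j)
      (by intro x y; simp only [mem_Icc]; omega)]
    rw [← Finset.Ico_add_one_right_eq_Icc k (N + 1), Finset.sum_eq_sum_Ico_succ_bot (by omega),
      ← Finset.Ico_add_one_right_eq_Icc k N,
      ← Finset.sum_Ico_add' _ k (N + 1) 1]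
    simp only [lowCols, lt_irrefl, if_false, sum_empty, sum_const_zero, zero_add]
    refine sum_congr rfl fun j hj => ?_
    rw [mem_Ico] at hj
    rw [if_pos (by omega), sum_comm]
    rfl
  have hexp : ∀ lam : ℕ → ℕ → ℤ, gtWeight N k θ w (particle θ lam) * ∑ j ∈ Icc k (N + 1), c j *
      ((∑ p ∈ upCols N j,
          if particle θ lam j p = s - 1 then
            (upCoeff N k θ (particle θ lam) j p s : ℂ) else 0) -
        ∑ p ∈ lowCols k j,
          if particle θ lam (j - 1) p = s then
            (lowCoeff N k θ (particle θ lam) j p s : ℂ) else 0) =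
      ∑ j ∈ Icc k (N + 1), (∑ p ∈ upCols N j,
      (if particle θ lam j p = s - 1 then gtWeight N k θ w (particle θ lam) *
        (c j * upCoeff N k θ (particle θ lam) j p s) else 0)) -
      ∑ j ∈ Icc k (N + 1), ∑ p ∈ lowCols k j,
      (if particle θ lam (j - 1) p = s then gtWeight N k θ w (particle θ lam) *
        (c j * lowCoeff N k θ (particle θ lam) j p s) else 0) := by
    intro lam
    simp only [mul_sum, mul_sub, mul_ite, mul_zero, sum_sub_distrib]
  rw [sum_congr rfl fun lam _ => hexp lam, sum_sub_distrib, hU, hL, ← sum_sub_distrib,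
    sum_congr rfl fun p hp => upResidue_sub_lowResidue hθ hkN (mem_Icc.1 hp).1 (mem_Icc.1 hp).2 s
      hc, sum_sub_distrib, sum_ite_eq', sum_ite_eq', 
    if_pos (show 1 ∈ Icc 1 N by rw [mem_Icc]; omega),
    if_pos (show N ∈ Icc 1 N by rw [mem_Icc]; omega)]

/-! ### The residue of a single term -/

open Filter Topology in
theorem tendsto_prod_div {S : Finset ℕ} {a b : ℕ → ℂ} {s : ℂ} (h : ∀ q ∈ S, b q ≠ s) :
    Tendsto (fun z => ∏ q ∈ S, (z - a q) / (z - b q)) (𝓝[≠] s)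
      (𝓝 (∏ q ∈ S, (s - a q) / (s - b q))) := by
  refine (tendsto_finsetProd _ fun q hq => ?_).mono_left nhdsWithin_le_nhds
  exact (tendsto_id.sub_const _).div (tendsto_id.sub_const _) (sub_ne_zero.2 (h q hq).symm)

open Filter Topology in
theorem tendsto_sub_mul_prod_div {S : Finset ℕ} {a b : ℕ → ℂ} {s : ℂ} {p : ℕ} (hp : p ∈ S)
    (hb : b p = s) (h : ∀ q ∈ S, q ≠ p → b q ≠ s) :
    Tendsto (fun z => (z - s) * ∏ q ∈ S, (z - a q) / (z - b q)) (𝓝[≠] s)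
      (𝓝 ((s - a p) * ∏ q ∈ S.erase p, (s - a q) / (s - b q))) := by
  have h1 : Tendsto (fun z => (z - a p) * ∏ q ∈ S.erase p, (z - a q) / (z - b q)) (𝓝[≠] s)
      (𝓝 ((s - a p) * ∏ q ∈ S.erase p, (s - a q) / (s - b q))) :=
    ((tendsto_id.sub_const _).mono_left nhdsWithin_le_nhds).mul
      (tendsto_prod_div fun q hq => h q (mem_erase.1 hq).2 (mem_erase.1 hq).1)
  refine h1.congr' ?_
  filter_upwards [self_mem_nhdsWithin] with z hz
  have hz' : z - s ≠ 0 := sub_ne_zero.2 hz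
  rw [← mul_prod_erase _ _ hp, hb]
  field_simp

/-- A pole is cancelled by a zero of the numerator. -/
theorem exists_tendsto_prod_div {S : Finset ℕ} {a b : ℕ → ℂ} {s : ℂ} {p r : ℕ} (hp : p ∈ S)
    (hr : r ∈ S) (hpr : r ≠ p) (hb : b p = s) (ha : a r = s) (h : ∀ q ∈ S, q ≠ p → b q ≠ s) :
    ∃ L, Filter.Tendsto (fun z => ∏ q ∈ S, (z - a q) / (z - b q)) (nhdsWithin s {s}ᶜ)
      (nhds L) := by
  have hr' : r ∈ S.erase p := mem_erase.2 ⟨hpr, hr⟩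
  refine ⟨(s - a p) / (s - b r) * ∏ q ∈ (S.erase p).erase r, (s - a q) / (s - b q), ?_⟩
  have h1 : Filter.Tendsto (fun z => (z - a p) / (z - b r) *
      ∏ q ∈ (S.erase p).erase r, (z - a q) / (z - b q)) (nhdsWithin s {s}ᶜ)
      (nhds ((s - a p) / (s - b r) * ∏ q ∈ (S.erase p).erase r, (s - a q) / (s - b q))) := by
    refine Filter.Tendsto.mul (Filter.Tendsto.mono_left ?_ nhdsWithin_le_nhds)
      (tendsto_prod_div fun q hq => ?_)
    · exact (Filter.tendsto_id.sub_const _).div (Filter.tendsto_id.sub_const _)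
        (sub_ne_zero.2 (h r hr hpr).symm)
    · rw [mem_erase, mem_erase] at hq
      exact h q hq.2.2 hq.2.1
  refine h1.congr' ?_
  filter_upwards [self_mem_nhdsWithin] with z hz
  have hz' : z - s ≠ 0 := sub_ne_zero.2 hz
  rw [← mul_prod_erase _ _ hp, ← mul_prod_erase _ _ hr', hb, ha]
  field_simp

/-- The product in the `j`-th term of `R₁`, for one configuration; `j = k` and `j = N + 1` give the
first two terms. -/
noncomputable def nodeTerm (N k : ℕ) (θ : ℝ) (ℓ : ℕ → ℕ → ℝ) (j : ℕ) (z : ℂ) : ℂ :=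
  (∏ q ∈ upCols N j, (z - (ℓ j q + upShift k θ j : ℝ)) / (z - (ℓ j q + 1 : ℝ))) *
    ∏ q ∈ lowCols k j, (z - (ℓ (j - 1) q + lowShift N θ j : ℝ)) / (z - (ℓ (j - 1) q : ℝ))

/-- The coefficient of the `j`-th term of `R₁`. -/
noncomputable def nodeCoeff (N k : ℕ) (θ : ℝ) (j : ℕ) : ℂ :=
  if j = k ∨ j = N + 1 then 1 else θ / (1 - θ)

namespace IsGTArray

variable {N k M : ℕ} {lam : ℕ → ℕ → ℤ} {θ : ℝ}

theorem particle_inj (h : IsGTArray N k M lam) (hθ : 0 < θ) {j p q : ℕ} (hkj : k ≤ j)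
    (hjN : j ≤ N) (hp : p ∈ Icc 1 j) (hq : q ∈ Icc 1 j)
    (e : particle θ lam j p = particle θ lam j q) : p = q := by
  rw [mem_Icc] at hp hq
  rcases lt_trichotomy p q with hlt | heq | hgt
  · have := h.row_gap hθ hkj hjN hp.1 hlt hq.2
    linarith
  · exact heq
  · have := h.row_gap hθ hkj hjN hq.1 hgt hp.2
    linarith

/-- If both levels contribute a pole at the same point, then both products have a zero there as
well. This only happens if `1 / θ` is an integer. -/
theorem eq_of_double_pole (h : IsGTArray N k M lam) (hθ : 0 < θ) (hθ1 : θ ≠ 1) {i p q : ℕ}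
    (hki : k ≤ i) (hiN : i < N) (hp : p ∈ Icc 1 (i + 1)) (hq : q ∈ Icc 1 i)
    (e : particle θ lam (i + 1) p + 1 = particle θ lam i q) :
    q + 2 ≤ p ∧ lam (i + 1) (q + 1) = lam i q ∧ lam i (p - 1) = lam (i + 1) p ∧
      lam (i + 1) p = lam i q := by
  rw [mem_Icc] at hp hq
  have hqp : q < p := by
    by_contra hcon
    have := h.link_gap_le hθ hki hiN hp.1 (not_lt.1 hcon) hq.2
    linarith
  have h1 := h.le_of_lt hki hiN hq.1 hqp hp.2
  have h2 := particle_sub θ lam i (i + 1) q p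
  have h3 : (q : ℝ) + 1 ≤ p := by exact_mod_cast hqp
  have h4 : lam (i + 1) p = lam i q := by
    have : ((lam i q - lam (i + 1) p : ℤ) : ℝ) < 1 := by nlinarith
    have : lam i q - lam (i + 1) p < 1 := by exact_mod_cast this
    omega
  have h5 : q + 2 ≤ p := by
    by_contra hcon
    have : p = q + 1 := by omega
    subst this
    rw [h4, sub_self] at h2
    push_cast at h2
    apply hθ1
    linarith
  have h6 := h.le_of_lt hki hiN hq.1 (Nat.lt_succ_self q) (by omega)
  have h7 : lam (i + 1) p ≤ lam (i + 1) (q + 1) :=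
    h.anti_row (by omega) (by omega) (by omega) (by omega) hp.2
  have h8 : lam (i + 1) p ≤ lam i (p - 1) :=
    h.le_of_lt hki hiN (by omega) (by omega) hp.2
  have h9 : lam i (p - 1) ≤ lam i q :=
    h.anti_row (by omega) (by omega) (by omega) (by omega) (by omega)
  simp only [Nat.succ_eq_add_one] at h6
  exact ⟨h5, by omega, by omega, h4⟩

open Filter Topology in
/-- The residue of a single term at a real point. -/
theorem tendsto_nodeTerm (h : IsGTArray N k M lam) (hθ : 0 < θ) (hθ1 : θ ≠ 1) {j : ℕ}
    (hkj : k ≤ j) (hjN : j ≤ N + 1) (s : ℝ) :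
    Tendsto (fun z : ℂ => (z - s) * (nodeCoeff N k θ j * nodeTerm N k θ (particle θ lam) j z))
      (𝓝[≠] (s : ℂ)) (𝓝 (θ * ((∑ p ∈ upCols N j,
          if particle θ lam j p = s - 1 then
            (upCoeff N k θ (particle θ lam) j p s : ℂ) else 0) -
        ∑ p ∈ lowCols k j,
          if particle θ lam (j - 1) p = s then
            (lowCoeff N k θ (particle θ lam) j p s : ℂ) else 0))) := by
  have hθ1' : (1 : ℂ) - θ ≠ 0 := by
    rw [sub_ne_zero]
    exact_mod_cast hθ1.symm
  have hup : ∀ p ∈ upCols N j, j ≤ N ∧ p ∈ Icc 1 j := by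
    intro p hp
    unfold upCols at hp
    split_ifs at hp with hj
    · exact ⟨hj, hp⟩
    · simp at hp
  have hlow : ∀ p ∈ lowCols k j, k < j ∧ p ∈ Icc 1 (j - 1) := by
    intro p hp
    unfold lowCols at hp
    split_ifs at hp with hj
    · exact ⟨hj, hp⟩
    · simp at hp
  have hupinj : ∀ p ∈ upCols N j, ∀ q ∈ upCols N j, particle θ lam j p = s - 1 →
      particle θ lam j q = s - 1 → q = p := fun p hp q hq e e' =>
    h.particle_inj hθ hkj (hup p hp).1 (hup q hq).2 (hup p hp).2 (e'.trans e.symm)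
  have hlowinj : ∀ p ∈ lowCols k j, ∀ q ∈ lowCols k j, particle θ lam (j - 1) p = s →
      particle θ lam (j - 1) q = s → q = p := fun p hp q hq e e' =>
    h.particle_inj hθ (by have := (hlow p hp).1; omega) (by omega) (hlow q hq).2 (hlow p hp).2
      (e'.trans e.symm)
  have hupne : ∀ q, (((particle θ lam j q + 1 : ℝ) : ℂ) = s ↔ particle θ lam j q = s - 1) := by
    intro q
    rw [Complex.ofReal_inj, eq_sub_iff_add_eq]
  have hlowne : ∀ q, (((particle θ lam (j - 1) q : ℝ) : ℂ) = s ↔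
      particle θ lam (j - 1) q = s) := fun q => Complex.ofReal_inj
  have hcu : j ≤ N → nodeCoeff N k θ j * (1 - upShift k θ j : ℝ) = θ := by
    intro hj
    unfold nodeCoeff upShift
    by_cases hjk : j = k
    · rw [if_pos (Or.inl hjk), if_pos hjk]
      push_cast
      ring
    · rw [if_neg (by omega), if_neg hjk]
      push_cast
      field_simp
  have hcl : k < j → nodeCoeff N k θ j * (lowShift N θ j : ℝ) = θ := by
    intro hj
    unfold nodeCoeff lowShift
    by_cases hjk : j = N + 1
    · rw [if_pos (Or.inr hjk), if_pos hjk]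
      ring
    · rw [if_neg (by omega), if_neg hjk]
      push_cast
      field_simp
  by_cases hP : ∃ p ∈ upCols N j, particle θ lam j p = s - 1
  · obtain ⟨p, hp, ep⟩ := hP
    rw [sum_eq_single p (fun q hq hqp => if_neg fun e => hqp (hupinj p hp q hq ep e))
      (fun h => absurd hp h), if_pos ep]
    have hothers : ∀ q ∈ upCols N j, q ≠ p → ((particle θ lam j q + 1 : ℝ) : ℂ) ≠ s :=
      fun q hq hqp e => hqp (hupinj p hp q hq ep ((hupne q).1 e))
    by_cases hQ : ∃ q ∈ lowCols k j, particle θ lam (j - 1) q = s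
    -- A double pole: particle `q + 1` of the upper level cancels one factor `z - s`, particle `p - 1`
    -- of the lower level the other one.
    · obtain ⟨q, hq, eq⟩ := hQ
      rw [sum_eq_single q (fun r hr hqr => if_neg fun e => hqr (hlowinj q hq r hr eq e))
        (fun h => absurd hq h), if_pos eq]
      obtain ⟨hkj', hq'⟩ := hlow q hq
      obtain ⟨hjN', hp'⟩ := hup p hp
      obtain ⟨i, rfl⟩ : ∃ i, j = i + 1 := ⟨j - 1, by omega⟩
      rw [Nat.add_sub_cancel] at hq' eq
      obtain ⟨d1, d2, d3, d4⟩ := h.eq_of_double_pole hθ hθ1 (by omega) (by omega) hp' hq'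
        (by rw [ep, eq]; ring)
      have hsp : s = ((lam (i + 1) p + 1 : ℤ) : ℝ) - p * θ := by
        unfold particle at ep
        push_cast
        linarith
      have hsq : s = (lam i q : ℝ) - q * θ := eq.symm
      have z1 : upCoeff N k θ (particle θ lam) (i + 1) p s = 0 := by
        rw [mem_Icc] at hp'
        rw [hsp]
        exact upCoeff_eq_zero_of_below hkj' hjN' (by omega) hp'.2 (by
          rw [Nat.add_sub_cancel, d3]; ring)
      have z2 : lowCoeff N k θ (particle θ lam) (i + 1) q s = 0 := by
        rw [mem_Icc] at hp'
        rw [hsq]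
        exact lowCoeff_eq_zero_of_above hkj' hjN' (by omega) d2
      rw [z1, z2, Complex.ofReal_zero, sub_zero, mul_zero]
      rw [mem_Icc] at hp' hq'
      obtain ⟨L, hL⟩ := exists_tendsto_prod_div (S := upCols N (i + 1))
        (a := fun q => ((particle θ lam (i + 1) q + upShift k θ (i + 1) : ℝ) : ℂ))
        (b := fun q => ((particle θ lam (i + 1) q + 1 : ℝ) : ℂ)) (s := s) (p := p) (r := q + 1)
        hp (by rw [upCols, if_pos hjN', mem_Icc]; omega) (by omega) ((hupne p).2 ep)
        (by
          rw [Complex.ofReal_inj, upShift, if_neg (by omega), hsq, particle, d2]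
          push_cast
          ring) hothers
      have hR := tendsto_sub_mul_prod_div (S := lowCols k (i + 1))
        (a := fun q => ((particle θ lam (i + 1 - 1) q + lowShift N θ (i + 1) : ℝ) : ℂ))
        (b := fun q => ((particle θ lam (i + 1 - 1) q : ℝ) : ℂ)) (s := s)
        hq ((hlowne q).2 eq) (fun r hr hrq e => hrq (hlowinj q hq r hr eq ((hlowne r).1 e)))
      rw [prod_eq_zero (i := p - 1) (s := (lowCols k (i + 1)).erase q), mul_zero] at hR
      · have := (hL.mul hR).const_mul (nodeCoeff N k θ (i + 1))
        rw [mul_zero, mul_zero] at this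
        refine this.congr fun z => ?_
        unfold nodeTerm
        ring
      · rw [mem_erase, lowCols, if_pos hkj', mem_Icc]; omega
      · rw [Nat.add_sub_cancel, particle, d3, lowShift, if_neg (by omega), ← Complex.ofReal_sub,
          hsp, Nat.cast_sub (by omega)]
        push_cast
        ring
    · push Not at hQ
      rw [sum_eq_zero (fun q hq => if_neg (hQ q hq)), sub_zero]
      have hL := tendsto_sub_mul_prod_div
        (a := fun q => ((particle θ lam j q + upShift k θ j : ℝ) : ℂ))
        (b := fun q => ((particle θ lam j q + 1 : ℝ) : ℂ)) (s := s) hp ((hupne p).2 ep) hothers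
      have hR := tendsto_prod_div (S := lowCols k j)
        (a := fun q => ((particle θ lam (j - 1) q + lowShift N θ j : ℝ) : ℂ))
        (b := fun q => ((particle θ lam (j - 1) q : ℝ) : ℂ)) (s := s)
        (fun q hq e => hQ q hq ((hlowne q).1 e))
      convert ((hL.mul hR).const_mul (nodeCoeff N k θ j)) using 2
      · unfold nodeTerm
        ring
      · rw [← hcu (hup p hp).1, ep, upCoeff]
        push_cast
        simp only [sub_sub]
        ring
  · push Not at hP
    rw [sum_eq_zero (fun q hq => if_neg (hP q hq)), zero_sub]
    have hL := tendsto_prod_div (S := upCols N j)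
      (a := fun q => ((particle θ lam j q + upShift k θ j : ℝ) : ℂ))
      (b := fun q => ((particle θ lam j q + 1 : ℝ) : ℂ)) (s := s)
      (fun q hq e => hP q hq ((hupne q).1 e))
    by_cases hQ : ∃ q ∈ lowCols k j, particle θ lam (j - 1) q = s
    · obtain ⟨q, hq, eq⟩ := hQ
      rw [sum_eq_single q (fun r hr hqr => if_neg fun e => hqr (hlowinj q hq r hr eq e))
        (fun h => absurd hq h), if_pos eq]
      have hR := tendsto_sub_mul_prod_div (S := lowCols k j)
        (a := fun q => ((particle θ lam (j - 1) q + lowShift N θ j : ℝ) : ℂ))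
        (b := fun q => ((particle θ lam (j - 1) q : ℝ) : ℂ)) (s := s)
        hq ((hlowne q).2 eq) (fun r hr hrq e => hrq (hlowinj q hq r hr eq ((hlowne r).1 e)))
      convert ((hL.mul hR).const_mul (nodeCoeff N k θ j)) using 2
      · unfold nodeTerm
        ring
      · rw [← hcl (hlow q hq).1, eq, lowCoeff]
        push_cast
        simp only [sub_sub]
        ring
    · push Not at hQ
      rw [sum_eq_zero (fun q hq => if_neg (hQ q hq)), neg_zero, mul_zero]
      have hR := tendsto_prod_div (S := lowCols k j)
        (a := fun q => ((particle θ lam (j - 1) q + lowShift N θ j : ℝ) : ℂ))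
        (b := fun q => ((particle θ lam (j - 1) q : ℝ) : ℂ)) (s := s)
        (fun q hq e => hQ q hq ((hlowne q).1 e))
      have hz : Tendsto (fun z : ℂ => z - s) (𝓝[≠] (s : ℂ)) (𝓝 0) := by
        have := ((tendsto_id (α := ℂ) (x := 𝓝 (s : ℂ))).sub_const (s : ℂ)).mono_left
          (nhdsWithin_le_nhds (s := {(s : ℂ)}ᶜ))
        simpa using this
      have := hz.mul ((hL.mul hR).const_mul (nodeCoeff N k θ j))
      rw [zero_mul] at this
      exact this

end IsGTArray

/-! ### Analytic continuation of the first expression -/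

open Filter Topology in
/-- Riemann's theorem on removable singularities, for finitely many points. -/
theorem exists_analyticOnNhd_of_tendsto {U S : Set ℂ} {f : ℂ → ℂ} (hU : IsOpen U) (hS : S.Finite)
    (hd : ∀ z ∈ U, z ∉ S → DifferentiableAt ℂ f z)
    (hlim : ∀ s ∈ S, s ∈ U → Tendsto (fun z => (z - s) * f z) (𝓝[≠] s) (𝓝 0)) :
    ∃ G : ℂ → ℂ, AnalyticOnNhd ℂ G U ∧ ∀ z ∈ U, z ∉ S → G z = f z := by
  classical
  refine ⟨fun z => if z ∈ S then limUnder (𝓝[≠] z) f else f z, ?_, fun z _ hz => if_neg hz⟩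
  have key : ∀ c ∈ U, ∃ V ∈ 𝓝 c, DifferentiableOn ℂ
      (fun z => if z ∈ S then limUnder (𝓝[≠] z) f else f z) V := by
    intro c hc
    have hV : U ∩ (S \ {c})ᶜ ∈ 𝓝 c := inter_mem (hU.mem_nhds hc)
      ((hS.subset Set.sdiff_subset).isClosed.isOpen_compl.mem_nhds (by simp))
    refine ⟨_, hV, ?_⟩
    have hdV : DifferentiableOn ℂ f ((U ∩ (S \ {c})ᶜ) \ {c}) := by
      rintro z ⟨⟨h1, h2⟩, h3⟩
      exact (hd z h1 fun h => h2 ⟨h, h3⟩).differentiableWithinAt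
    by_cases hcS : c ∈ S
    · have ho : (fun z => f z - f c) =o[𝓝[≠] c] fun z => (z - c)⁻¹ := by
        refine (Asymptotics.isLittleO_iff_tendsto' ?_).2 ?_
        · filter_upwards [self_mem_nhdsWithin] with z hz h0
          exact absurd h0 (inv_ne_zero (sub_ne_zero.2 hz))
        · have h1 : Tendsto (fun z : ℂ => (z - c) * f c) (𝓝[≠] c) (𝓝 0) := by
            have : Tendsto (fun z : ℂ => (z - c) * f c) (𝓝 c) (𝓝 ((c - c) * f c)) :=
              (tendsto_id.sub_const c).mul_const _
            rw [sub_self, zero_mul] at this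
            exact this.mono_left nhdsWithin_le_nhds
          have h2 := (hlim c hcS hc).sub h1
          rw [sub_zero] at h2
          refine h2.congr fun z => ?_
          rw [div_inv_eq_mul]
          ring
      have := Complex.differentiableOn_update_limUnder_of_isLittleO hV hdV ho
      refine this.congr ?_
      rintro z ⟨h1, h2⟩
      by_cases hzc : z = c
      · subst hzc
        simp [hcS]
      · rw [Function.update_of_ne hzc, if_neg fun h => h2 ⟨h, hzc⟩]
    · rintro z ⟨h1, h2⟩
      have hzS : z ∉ S := fun h => h2 ⟨h, fun e => hcS (by
        rw [← Set.mem_singleton_iff.1 e]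
        exact h)⟩
      refine (DifferentiableAt.congr_of_eventuallyEq (hd z h1 hzS) ?_).differentiableWithinAt
      filter_upwards [hS.isClosed.isOpen_compl.mem_nhds hzS] with y hy
      exact if_neg hy
  intro c hc
  obtain ⟨V, hV, hdV⟩ := key c hc
  exact hdV.analyticAt hV

theorem nekLattice_finite (N M : ℕ) (θ : ℝ) : (nekLattice N M θ).Finite := by
  refine ((Finset.finite_toSet (range (M + 2) ×ˢ range (N + 1))).image
    (fun x : ℕ × ℕ => (x.1 : ℂ) - x.2 * θ)).subset ?_
  rintro z ⟨a, b, ha, -, hb, rfl⟩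
  refine ⟨(a, b), ?_, rfl⟩
  simp only [coe_product, coe_range, Set.mem_prod, Set.mem_Iio]
  omega

/-- A configuration's contribution to `R₁`, before the boundary terms are subtracted. -/
noncomputable def nodeSum (N k : ℕ) (θ : ℝ) (φ : ℕ → ℂ → ℂ) (ℓ : ℕ → ℕ → ℝ) (z : ℂ) : ℂ :=
  ∑ j ∈ Icc k (N + 1), φ j z * (nodeCoeff N k θ j * nodeTerm N k θ ℓ j z)

theorem gtExp_const_mul (N k M : ℕ) (θ : ℝ) (w : ℕ → ℝ → ℂ) (f : (ℕ → ℕ → ℝ) → ℂ) (c : ℂ) :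
    gtExp N k M θ w (fun ℓ => c * f ℓ) = c * gtExp N k M θ w f := by
  unfold gtExp
  rw [mul_sum]
  exact sum_congr rfl fun _ _ => by ring

theorem gtExp_sum (N k M : ℕ) (θ : ℝ) (w : ℕ → ℝ → ℂ) {ι : Type} (s : Finset ι)
    (f : ι → (ℕ → ℕ → ℝ) → ℂ) :
    gtExp N k M θ w (fun ℓ => ∑ i ∈ s, f i ℓ) = ∑ i ∈ s, gtExp N k M θ w (f i) := by
  unfold gtExp
  rw [sum_comm]
  exact sum_congr rfl fun _ _ => by rw [mul_sum]

theorem sum_levels {k N : ℕ} (hkN : k ≤ N) (F : ℕ → ℂ) :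
    ∑ j ∈ Icc k (N + 1), F j = F (N + 1) + F k + ∑ j ∈ Icc (k + 1) N, F j := by
  rw [← Finset.Ico_add_one_right_eq_Icc k (N + 1), Finset.sum_Ico_succ_top (by omega),
    Finset.sum_eq_sum_Ico_succ_bot (by omega), Finset.Ico_add_one_right_eq_Icc]
  ring

theorem nekR1_eq {N k M : ℕ} {θ : ℝ} (hkN : k ≤ N) (w : ℕ → ℝ → ℂ) (φ : ℕ → ℂ → ℂ) (z : ℂ) :
    nekR1 N k M θ w φ z =
      gtExp N k M θ w (fun ℓ => nodeSum N k θ φ ℓ z) - nekRes1 N k M θ w φ z := by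
  have h1 : ∀ ℓ : ℕ → ℕ → ℝ, nodeTerm N k θ ℓ (N + 1) z =
      ∏ p ∈ Icc 1 N, (z - ℓ N p - θ) / (z - ℓ N p) := by
    intro ℓ
    rw [nodeTerm, upCols, if_neg (by omega), prod_empty, one_mul, lowCols, if_pos (by omega),
      Nat.add_sub_cancel]
    refine prod_congr rfl fun p _ => ?_
    rw [lowShift, if_pos rfl]
    push_cast
    rw [sub_sub]
  have h2 : ∀ ℓ : ℕ → ℕ → ℝ, nodeTerm N k θ ℓ k z =
      ∏ p ∈ Icc 1 k, (z - ℓ k p + θ - 1) / (z - ℓ k p - 1) := by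
    intro ℓ
    rw [nodeTerm, lowCols, if_neg (by omega), prod_empty, mul_one, upCols, if_pos hkN]
    refine prod_congr rfl fun p _ => ?_
    rw [upShift, if_pos rfl]
    push_cast
    congr 1 <;> ring
  have h3 : ∀ j ∈ Icc (k + 1) N, ∀ ℓ : ℕ → ℕ → ℝ, nodeTerm N k θ ℓ j z =
      (∏ p ∈ Icc 1 j, (z - ℓ j p - θ) / (z - ℓ j p - 1)) *
      ∏ p ∈ Icc 1 (j - 1), (z - ℓ (j - 1) p + θ - 1) / (z - ℓ (j - 1) p) := by
    intro j hj ℓ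
    rw [mem_Icc] at hj
    rw [nodeTerm, lowCols, if_pos (by omega), upCols, if_pos hj.2, upShift, if_neg (by omega),
      lowShift, if_neg (by omega)]
    congr 1
    · refine prod_congr rfl fun p _ => ?_
      push_cast
      congr 1 <;> ring
    · refine prod_congr rfl fun p _ => ?_
      push_cast
      congr 1
      ring
  unfold nekR1 nodeSum
  congr 1
  rw [gtExp_sum, sum_levels hkN, gtExp_const_mul, gtExp_const_mul, gtExp_const_mul,
    gtExp_const_mul, nodeCoeff, if_pos (Or.inr rfl), nodeCoeff, if_pos (Or.inl rfl), one_mul,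
    one_mul]
  simp_rw [h1, h2]
  congr 1
  rw [mul_sum]
  refine sum_congr rfl fun j hj => ?_
  rw [gtExp_const_mul, gtExp_const_mul, nodeCoeff,
    if_neg (by rw [mem_Icc] at hj; omega)]
  simp_rw [h3 j hj]
  ring

/-- The boundary terms collect the residues of the first column at its largest position and of the
last column at its smallest position. -/
theorem nekRes1_eq {N k M : ℕ} {θ : ℝ} (hk : 1 ≤ k) (hkN : k ≤ N) (w : ℕ → ℝ → ℂ)
    (φ : ℕ → ℂ → ℂ) (z : ℂ) :
    nekRes1 N k M θ w φ z =
      (gtPartition N k M θ w)⁻¹ * θ *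
        (upResidue N k M θ w (fun j => φ j ((M + 1 - θ : ℝ) : ℂ)) 1 (M + 1 - θ) /
            (z - (M + 1 - θ : ℝ)) -
          lowResidue N k M θ w (fun j => φ j ((-(N * θ) : ℝ) : ℂ)) N (-(N * θ)) /
            (z - (-(N * θ) : ℝ))) := by
  have e1 : ∀ j ∈ Icc k N, upCols N j = Icc 1 j := fun j hj =>
    if_pos (mem_Icc.1 hj).2
  have e2 : ∀ j, (Icc 1 j).erase 1 = Icc 2 j := by
    intro j
    ext q
    simp only [mem_erase, mem_Icc]
    omega
  have e3 : (Icc 1 N).erase N = Icc 1 (N - 1) := by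
    ext q
    simp only [mem_erase, mem_Icc]
    omega
  have hL : lowResidue N k M θ w (fun j => φ j ((-(N * θ) : ℝ) : ℂ)) N (-(N * θ)) =
      φ (N + 1) (-(N * θ)) * ∑ lam ∈ gtArrays N k M, gtWeight N k θ w (particle θ lam) *
        ((∏ p ∈ Icc 1 (N - 1), ((particle θ lam N p : ℂ) + (N + 1) * θ) /
          ((particle θ lam N p : ℂ) + N * θ)) *
          (if particle θ lam N N = -(N * θ) then 1 else 0)) := by
    unfold lowResidue
    rw [max_eq_right hkN, Icc_self, sum_singleton, mul_sum]
    refine sum_congr rfl fun lam _ => ?_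
    split_ifs with h
    · rw [lowCoeff, upCols, if_neg (by omega), prod_empty, one_mul, lowCols, if_pos (by omega),
        Nat.add_sub_cancel, e3, lowShift, if_pos rfl]
      push_cast
      have : ∀ p, (-((N : ℂ) * θ) - particle θ lam N p - θ) / (-(N * θ) - particle θ lam N p) =
          ((particle θ lam N p : ℂ) + (N + 1) * θ) / ((particle θ lam N p : ℂ) + N * θ) := by
        intro p
        rw [← neg_div_neg_eq]
        congr 1 <;> ring
      simp_rw [this]
      ring
    · simp
  have hU : upResidue N k M θ w (fun j => φ j ((M + 1 - θ : ℝ) : ℂ)) 1 (M + 1 - θ) =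
      φ k ((M + 1 - θ : ℝ) : ℂ) *
        (∑ lam ∈ gtArrays N k M, gtWeight N k θ w (particle θ lam) *
          ((∏ p ∈ Icc 2 k, (((M + 1 - θ : ℝ) : ℂ) - particle θ lam k p + θ - 1) /
            (((M + 1 - θ : ℝ) : ℂ) - particle θ lam k p - 1)) *
          (if particle θ lam k 1 = M + 1 - θ - 1 then 1 else 0))) +
      ∑ j ∈ Icc (k + 1) N, φ j ((M + 1 - θ : ℝ) : ℂ) *
        (∑ lam ∈ gtArrays N k M, gtWeight N k θ w (particle θ lam) *
          ((∏ p ∈ Icc 2 j, (((M + 1 - θ : ℝ) : ℂ) - particle θ lam j p - θ) /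
            (((M + 1 - θ : ℝ) : ℂ) - particle θ lam j p - 1)) *
          (∏ p ∈ Icc 1 (j - 1), (((M + 1 - θ : ℝ) : ℂ) - particle θ lam (j - 1) p + θ - 1) /
            (((M + 1 - θ : ℝ) : ℂ) - particle θ lam (j - 1) p)) *
          (if particle θ lam j 1 = M + 1 - θ - 1 then 1 else 0))) := by
    unfold upResidue
    rw [max_eq_left hk, ← Finset.Ico_add_one_right_eq_Icc,
      Finset.sum_eq_sum_Ico_succ_bot (by omega), Finset.Ico_add_one_right_eq_Icc]
    congr 1
    · rw [mul_sum]
      refine sum_congr rfl fun lam _ => ?_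
      split_ifs with h
      · rw [upCoeff, e1 k (by rw [mem_Icc]; omega), e2, lowCols, if_neg (by omega), prod_empty,
          upShift, if_pos rfl]
        push_cast
        simp_rw [sub_sub_eq_add_sub]
        ring
      · simp
    · refine sum_congr rfl fun j hj => ?_
      rw [mem_Icc] at hj
      rw [mul_sum]
      refine sum_congr rfl fun lam _ => ?_
      split_ifs with h
      · rw [upCoeff, e1 j (by rw [mem_Icc]; omega), e2, lowCols, if_pos (by omega),
          upShift, if_neg (by omega), lowShift, if_neg (by omega)]
        push_cast
        simp_rw [sub_sub_eq_add_sub]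
        ring
      · simp
  rw [hL, hU, nekRes1]
  have hE : ∀ f, gtExp N k M θ w f = (gtPartition N k M θ w)⁻¹ *
      ∑ lam ∈ gtArrays N k M, gtWeight N k θ w (particle θ lam) * f (particle θ lam) := by
    intro f
    unfold gtExp gtProb
    rw [mul_sum]
    exact sum_congr rfl fun _ _ => by ring
  simp only [hE]
  rw [add_div, sum_div]
  have hz : z - ((-(N * θ) : ℝ) : ℂ) = z + N * θ := by push_cast; ring
  rw [hz]
  rw [show ∀ a b c : ℂ, (gtPartition N k M θ w)⁻¹ * θ * (a + b - c) =
    -((gtPartition N k M θ w)⁻¹ * θ * c) + (gtPartition N k M θ w)⁻¹ * θ * a +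
      (gtPartition N k M θ w)⁻¹ * θ * b by intro a b c; ring]
  congr 1
  · congr 1
    · ring
    · ring
  · rw [mul_sum]
    exact sum_congr rfl fun j _ => by ring

open Filter Topology in
theorem tendsto_sub_mul_div (c a : ℂ) (s : ℂ) :
    Tendsto (fun z : ℂ => (z - s) * (c / (z - a))) (𝓝[≠] s) (𝓝 (if s = a then c else 0)) := by
  split_ifs with h
  · subst h
    refine tendsto_const_nhds.congr' ?_
    filter_upwards [self_mem_nhdsWithin] with z hz
    have : z - s ≠ 0 := sub_ne_zero.2 hz
    field_simp
  · have : Tendsto (fun z : ℂ => (z - s) * (c / (z - a))) (𝓝 s)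
        (𝓝 ((s - s) * (c / (s - a)))) :=
      (tendsto_id.sub_const s).mul (tendsto_const_nhds.div (tendsto_id.sub_const a)
        (sub_ne_zero.2 h))
    rw [sub_self, zero_mul] at this
    exact this.mono_left nhdsWithin_le_nhds

theorem mem_nekLattice_of_int {N M b : ℕ} {θ : ℝ} {a : ℤ} (ha0 : 0 ≤ a) (haM : a ≤ M + 1)
    (hb1 : 1 ≤ b) (hbN : b ≤ N) : ((a : ℂ) - b * θ) ∈ nekLattice N M θ := by
  refine ⟨a.toNat, b, by omega, hb1, hbN, ?_⟩
  congr 1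
  exact_mod_cast congrArg (Int.cast : ℤ → ℂ) (Int.toNat_of_nonneg ha0).symm

open Filter Topology in
/-- At every point of the lattice the residues of `R₁` add up to zero, so `R₁` extends
analytically. -/
theorem exists_analyticOnNhd_nekR1 {N k M : ℕ} {θ : ℝ} (hk : 1 ≤ k) (hkN : k ≤ N) (hθ : 0 < θ)
    (hθ1 : θ ≠ 1) (w : ℕ → ℝ → ℂ) {U : Set ℂ} (hU : IsOpen U) (φ : ℕ → ℂ → ℂ)
    (hφ : ∀ j, k ≤ j → j ≤ N + 1 → AnalyticOnNhd ℂ (φ j) U)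
    (hr : ∀ j, k ≤ j → j ≤ N → ∀ x ∈ Set.Icc (1 - j * θ) (M - θ),
      φ (j + 1) (x : ℂ) * w j x = φ j (x : ℂ) * w j (x - 1)) :
    ∃ G : ℂ → ℂ, AnalyticOnNhd ℂ G U ∧
      ∀ z ∈ U, z ∉ nekLattice N M θ → G z = nekR1 N k M θ w φ z := by
  refine exists_analyticOnNhd_of_tendsto hU (nekLattice_finite N M θ) ?_ ?_
  · intro z hz hzL
    have hne : ∀ a : ℤ, ∀ b : ℕ, 0 ≤ a → a ≤ M + 1 → 1 ≤ b → b ≤ N → z - ((a : ℂ) - b * θ) ≠ 0 :=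
      fun a b h1 h2 h3 h4 h => hzL (by
        rw [sub_eq_zero.1 h]; exact mem_nekLattice_of_int h1 h2 h3 h4)
    have hnode : ∀ lam ∈ gtArrays N k M, ∀ j ∈ Icc k (N + 1),
        DifferentiableAt ℂ (nodeTerm N k θ (particle θ lam) j) z := by
      intro lam hl j hj
      rw [mem_gtArrays] at hl
      rw [mem_Icc] at hj
      unfold nodeTerm
      refine DifferentiableAt.mul (DifferentiableAt.fun_finsetProd fun q hq => ?_)
        (DifferentiableAt.fun_finsetProd fun q hq => ?_)
      · unfold upCols at hq
        split_ifs at hq with hjN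
        · rw [mem_Icc] at hq
          have h1 := hl.2.1 j q hj.1 hjN hq.1 hq.2
          refine (differentiableAt_id.sub_const _).div (differentiableAt_id.sub_const _) ?_
          convert hne (lam j q + 1) q (by omega) (by omega) hq.1 (by omega) using 2
          simp only [particle]
          push_cast
          ring
        · simp at hq
      · unfold lowCols at hq
        split_ifs at hq with hjk
        · rw [mem_Icc] at hq
          have h1 := hl.2.1 (j - 1) q (by omega) (by omega) hq.1 hq.2
          refine (differentiableAt_id.sub_const _).div (differentiableAt_id.sub_const _) ?_
          convert hne (lam (j - 1) q) q (by omega) (by omega) hq.1 (by omega) using 2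
          simp only [particle]
          push_cast
          ring
        · simp at hq
    rw [show nekR1 N k M θ w φ = fun z => gtExp N k M θ w (fun ℓ => nodeSum N k θ φ ℓ z) -
      nekRes1 N k M θ w φ z from funext fun z => nekR1_eq hkN w φ z]
    refine DifferentiableAt.sub ?_ ?_
    · unfold gtExp nodeSum
      refine DifferentiableAt.fun_sum fun lam hl => DifferentiableAt.const_mul ?_ _
      refine DifferentiableAt.fun_sum fun j hj => ?_
      rw [mem_Icc] at hj
      exact (hφ j hj.1 hj.2 z hz).differentiableAt.mul
        ((hnode lam hl j (by rw [mem_Icc]; exact hj)).const_mul _)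
    · rw [show nekRes1 N k M θ w φ = _ from funext fun z => nekRes1_eq hk hkN w φ z]
      refine DifferentiableAt.const_mul (DifferentiableAt.sub ?_ ?_) _
      · refine (differentiableAt_const _).div (differentiableAt_id.sub_const _) ?_
        convert hne (M + 1) 1 (by omega) le_rfl le_rfl (by omega) using 2
        push_cast
        ring
      · refine (differentiableAt_const _).div (differentiableAt_id.sub_const _) ?_
        convert hne 0 N le_rfl (by omega) (by omega) le_rfl using 2
        push_cast
        ring
  · intro s' hs hsU
    obtain ⟨s, rfl⟩ : ∃ s : ℝ, s' = s := by
      obtain ⟨a, b, -, -, -, rfl⟩ := hs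
      exact ⟨a - b * θ, by push_cast; rfl⟩
    have hmain : Tendsto (fun z : ℂ => (z - s) *
        gtExp N k M θ w (fun ℓ => nodeSum N k θ φ ℓ z)) (𝓝[≠] (s : ℂ))
        (𝓝 (∑ lam ∈ gtArrays N k M, gtProb N k M θ w (particle θ lam) *
          ∑ j ∈ Icc k (N + 1), φ j s * (θ * ((∑ p ∈ upCols N j,
          if particle θ lam j p = s - 1 then
            (upCoeff N k θ (particle θ lam) j p s : ℂ) else 0) -
        ∑ p ∈ lowCols k j,
          if particle θ lam (j - 1) p = s then
            (lowCoeff N k θ (particle θ lam) j p s : ℂ) else 0)))) := by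
      have h1 : ∀ lam ∈ gtArrays N k M, ∀ j ∈ Icc k (N + 1), Tendsto (fun z : ℂ =>
          φ j z * ((z - s) * (nodeCoeff N k θ j * nodeTerm N k θ (particle θ lam) j z)))
          (𝓝[≠] (s : ℂ)) (𝓝 (φ j s * (θ * ((∑ p ∈ upCols N j,
          if particle θ lam j p = s - 1 then
            (upCoeff N k θ (particle θ lam) j p s : ℂ) else 0) -
        ∑ p ∈ lowCols k j,
          if particle θ lam (j - 1) p = s then
            (lowCoeff N k θ (particle θ lam) j p s : ℂ) else 0)))) := by
        intro lam hl j hj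
        rw [mem_gtArrays] at hl
        rw [mem_Icc] at hj
        exact ((hφ j hj.1 hj.2 s hsU).continuousAt.tendsto.mono_left nhdsWithin_le_nhds).mul
          (hl.tendsto_nodeTerm hθ hθ1 hj.1 hj.2 s)
      have h2 := tendsto_finsetSum (gtArrays N k M) fun lam hl =>
        (tendsto_finsetSum (Icc k (N + 1)) fun j hj => h1 lam hl j hj).const_mul
          (gtProb N k M θ w (particle θ lam))
      refine h2.congr fun z => ?_
      unfold gtExp nodeSum
      rw [mul_sum]
      refine sum_congr rfl fun lam _ => ?_
      rw [mul_left_comm]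
      congr 1
      dsimp only
      rw [mul_sum]
      exact sum_congr rfl fun j _ => by ring
    have hres : Tendsto (fun z : ℂ => (z - s) * nekRes1 N k M θ w φ z) (𝓝[≠] (s : ℂ))
        (𝓝 ((gtPartition N k M θ w)⁻¹ * θ *
          ((if s = M + 1 - θ then upResidue N k M θ w (fun j => φ j s) 1 s else 0) -
        if s = -(N * θ) then lowResidue N k M θ w (fun j => φ j s) N s else 0))) := by
      have h1 := ((tendsto_sub_mul_div
        (upResidue N k M θ w (fun j => φ j ((M + 1 - θ : ℝ) : ℂ)) 1 (M + 1 - θ))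
        ((M + 1 - θ : ℝ) : ℂ) s).sub (tendsto_sub_mul_div
        (lowResidue N k M θ w (fun j => φ j ((-(N * θ) : ℝ) : ℂ)) N (-(N * θ)))
        ((-(N * θ) : ℝ) : ℂ) s)).const_mul ((gtPartition N k M θ w)⁻¹ * θ)
      have e : ((gtPartition N k M θ w)⁻¹ * θ *
          ((if s = M + 1 - θ then upResidue N k M θ w (fun j => φ j s) 1 s else 0) -
        if s = -(N * θ) then lowResidue N k M θ w (fun j => φ j s) N s else 0)) =
        (gtPartition N k M θ w)⁻¹ * θ *
        ((if (s : ℂ) = ((M + 1 - θ : ℝ) : ℂ) then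
          upResidue N k M θ w (fun j => φ j ((M + 1 - θ : ℝ) : ℂ)) 1 (M + 1 - θ) else 0) -
        if (s : ℂ) = ((-(N * θ) : ℝ) : ℂ) then
          lowResidue N k M θ w (fun j => φ j ((-(N * θ) : ℝ) : ℂ)) N (-(N * θ)) else 0) := by
        simp only [Complex.ofReal_inj]
        congr 2
        · split_ifs with h
          · rw [← h]
          · rfl
        · split_ifs with h
          · rw [← h]
          · rfl
      rw [e]
      refine h1.congr fun z => ?_
      rw [nekRes1_eq hk hkN]
      ring
    have htot := hmain.sub hres
    have hzero : (∑ lam ∈ gtArrays N k M, gtProb N k M θ w (particle θ lam) *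
          ∑ j ∈ Icc k (N + 1), φ j s * (θ * ((∑ p ∈ upCols N j,
          if particle θ lam j p = s - 1 then
            (upCoeff N k θ (particle θ lam) j p s : ℂ) else 0) -
        ∑ p ∈ lowCols k j,
          if particle θ lam (j - 1) p = s then
            (lowCoeff N k θ (particle θ lam) j p s : ℂ) else 0))) =
        (gtPartition N k M θ w)⁻¹ * θ *
          ((if s = M + 1 - θ then upResidue N k M θ w (fun j => φ j s) 1 s else 0) -
        if s = -(N * θ) then lowResidue N k M θ w (fun j => φ j s) N s else 0) := by
      rw [← sum_residues (c := fun j => φ j s) hθ hk hkN s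
        (fun i h1 h2 h3 => hr i h1 h2 s h3), mul_sum]
      refine sum_congr rfl fun lam _ => ?_
      unfold gtProb
      rw [mul_sum, mul_sum, mul_sum]
      exact sum_congr rfl fun j _ => by ring
    rw [hzero, sub_self] at htot
    refine htot.congr fun z => ?_
    rw [nekR1_eq hkN]
    ring

/-! ### Reflection of the state space -/

/-- The array with all particles reflected: level by level, `λ_p` becomes `M - λ_{j+1-p}`. -/
def reflectArray (N k M : ℕ) (lam : ℕ → ℕ → ℤ) : ℕ → ℕ → ℤ :=
  fun j p => if k ≤ j ∧ j ≤ N ∧ 1 ≤ p ∧ p ≤ j then M - lam j (j + 1 - p) else 0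

/-- The weight functions in the reflected coordinates. -/
def reflectWeight (M : ℕ) (θ : ℝ) (w : ℕ → ℝ → ℂ) : ℕ → ℝ → ℂ :=
  fun j x => w j (M - x - (j + 1) * θ)

/-- The point reflection of the complex plane that exchanges `-Nθ` and `M + 1 - θ`. -/
noncomputable def reflectPoint (N M : ℕ) (θ : ℝ) (z : ℂ) : ℂ := M + 1 - (N + 1) * θ - z

theorem prod_Icc_one_reflect {R : Type} [CommMonoid R] (n : ℕ) (F : ℕ → R) :
    ∏ p ∈ Icc 1 n, F (n + 1 - p) = ∏ p ∈ Icc 1 n, F p := by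
  refine prod_nbij' (fun p => n + 1 - p) (fun p => n + 1 - p) ?_ ?_ ?_ ?_ ?_ <;>
    simp only [mem_Icc] <;> intro p hp
  · omega
  · omega
  · omega
  · omega
  · trivial

theorem prod_Icc_two_reflect {R : Type} [CommMonoid R] (n : ℕ) (F : ℕ → R) :
    ∏ p ∈ Icc 2 n, F (n + 1 - p) = ∏ p ∈ Icc 1 (n - 1), F p := by
  refine prod_nbij' (fun p => n + 1 - p) (fun p => n + 1 - p) ?_ ?_ ?_ ?_ ?_ <;>
    simp only [mem_Icc] <;> intro p hp
  · omega
  · omega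
  · omega
  · omega
  · trivial

theorem prod_pairs_reflect {R : Type} [CommMonoid R] (n : ℕ) (F : ℕ → ℕ → R) :
    ∏ q ∈ Icc 1 n, ∏ p ∈ Ico 1 q, F (n + 1 - q) (n + 1 - p) =
      ∏ q ∈ Icc 1 n, ∏ p ∈ Ico 1 q, F p q := by
  rw [prod_sigma', prod_sigma']
  refine prod_nbij' (fun x => ⟨n + 1 - x.2, n + 1 - x.1⟩) (fun x => ⟨n + 1 - x.2, n + 1 - x.1⟩)
    ?_ ?_ ?_ ?_ ?_ <;> simp only [mem_sigma, mem_Icc, mem_Ico] <;> rintro ⟨q, p⟩ hp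
  · dsimp only at hp ⊢
    omega
  · dsimp only at hp ⊢
    omega
  · dsimp only at hp ⊢
    congr <;> omega
  · dsimp only at hp ⊢
    congr <;> omega
  · trivial

namespace IsGTArray

variable {N k M : ℕ} {lam : ℕ → ℕ → ℤ}

theorem reflect (h : IsGTArray N k M lam) : IsGTArray N k M (reflectArray N k M lam) := by
  refine ⟨fun j p hjp => if_neg hjp, fun j p h1 h2 h3 h4 => ?_, fun j p h1 h2 h3 h4 => ?_,
    fun j p h1 h2 h3 h4 => ?_⟩
  · have := h.2.1 j (j + 1 - p) h1 h2 (by omega) (by omega)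
    rw [reflectArray, if_pos ⟨h1, h2, h3, h4⟩]
    omega
  · have := h.2.2.1 j (j + 1 - (p + 1)) h1 h2 (by omega) (by omega)
    rw [show j + 1 - (p + 1) + 1 = j + 1 - p by omega] at this
    simp only [reflectArray]
    rw [if_pos (by omega), if_pos (by omega)]
    omega
  · have := h.2.2.2 j (j + 1 - p) h1 h2 (by omega) (by omega)
    rw [show j + 1 - p + 1 = j + 1 + 1 - p by omega] at this
    simp only [reflectArray]
    rw [if_pos (by omega), if_pos (by omega), if_pos (by omega),
      show j + 1 + 1 - (p + 1) = j + 1 - p by omega]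
    omega

theorem reflect_reflect (h : IsGTArray N k M lam) :
    reflectArray N k M (reflectArray N k M lam) = lam := by
  funext j p
  by_cases hjp : k ≤ j ∧ j ≤ N ∧ 1 ≤ p ∧ p ≤ j
  · simp only [reflectArray]
    rw [if_pos hjp, if_pos (by omega), show j + 1 - (j + 1 - p) = p by omega]
    ring
  · rw [reflectArray, if_neg hjp, h.1 j p hjp]

end IsGTArray

theorem particle_reflectArray {N k M : ℕ} (θ : ℝ) (lam : ℕ → ℕ → ℤ) {j p : ℕ} (hkj : k ≤ j)
    (hjN : j ≤ N) (hp : p ∈ Icc 1 j) :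
    particle θ (reflectArray N k M lam) j p = M - particle θ lam j (j + 1 - p) - (j + 1) * θ := by
  rw [mem_Icc] at hp
  rw [particle, particle, reflectArray, if_pos ⟨hkj, hjN, hp⟩, Nat.cast_sub (by omega)]
  push_cast
  ring

theorem particle_reflectArray' {N k M : ℕ} (θ : ℝ) (lam : ℕ → ℕ → ℤ) {j p : ℕ} (hkj : k ≤ j)
    (hjN : j ≤ N) (hp : p ∈ Icc 1 j) :
    particle θ (reflectArray N k M lam) j (j + 1 - p) = M - particle θ lam j p - (j + 1) * θ := by
  rw [mem_Icc] at hp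
  rw [particle_reflectArray θ lam hkj hjN (by rw [mem_Icc]; omega),
    show j + 1 - (j + 1 - p) = p by omega]

theorem gtWeight_reflect {N k M : ℕ} (hkN : k ≤ N) (θ : ℝ) (w : ℕ → ℝ → ℂ) (lam : ℕ → ℕ → ℤ) :
    gtWeight N k θ (reflectWeight M θ w) (particle θ (reflectArray N k M lam)) =
      gtWeight N k θ w (particle θ lam) := by
  rw [gtWeight_eq hkN, gtWeight_eq hkN]
  congr 1
  · rw [gammaWeight, gammaWeight]
    congr 2
    · refine prod_congr rfl fun j hj => ?_
      rw [mem_Icc] at hj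
      rw [rowFactor, rowFactor, ← prod_pairs_reflect]
      refine prod_congr rfl fun q hq => prod_congr rfl fun p hp => ?_
      rw [mem_Icc] at hq
      rw [mem_Ico] at hp
      rw [particle_reflectArray' θ lam hj.1 hj.2 (by rw [mem_Icc]; omega),
        particle_reflectArray' θ lam hj.1 hj.2 (by rw [mem_Icc]; omega)]
      congr 1
      ring
    · refine prod_congr rfl fun j hj => ?_
      rw [mem_Ico] at hj
      rw [linkFactor, linkFactor, ← prod_Icc_one_reflect j]
      refine prod_congr rfl fun r hr => ?_
      rw [← prod_Icc_one_reflect (j + 1)]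
      refine prod_congr rfl fun q hq => ?_
      rw [particle_reflectArray' θ lam hj.1 hj.2.le hr,
        particle_reflectArray' θ lam (by omega) hj.2 hq]
      rw [mem_Icc] at hr hq
      unfold crossFactor
      push_cast
      by_cases hrq : r < q
      · rw [if_pos hrq, if_neg (by omega)]
        congr 2 <;> ring
      · rw [if_neg hrq, if_pos (by omega)]
        congr 2 <;> ring
  · refine prod_congr rfl fun j hj => ?_
    rw [mem_Icc] at hj
    rw [← prod_Icc_one_reflect j]
    refine prod_congr rfl fun p hp => ?_
    rw [particle_reflectArray' θ lam hj.1 hj.2 hp, reflectWeight]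
    congr 1
    ring

theorem sum_gtArrays_reflect (N k M : ℕ) (F : (ℕ → ℕ → ℤ) → ℂ) :
    ∑ lam ∈ gtArrays N k M, F (reflectArray N k M lam) = ∑ lam ∈ gtArrays N k M, F lam := by
  refine sum_nbij' (reflectArray N k M) (reflectArray N k M) ?_ ?_ ?_ ?_ ?_ <;>
    intro lam hl <;> rw [mem_gtArrays] at hl
  · exact mem_gtArrays.2 hl.reflect
  · exact mem_gtArrays.2 hl.reflect
  · exact hl.reflect_reflect
  · exact hl.reflect_reflect

theorem gtExp_reflect {N k M : ℕ} (hkN : k ≤ N) (θ : ℝ) (w : ℕ → ℝ → ℂ)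
    {f g : (ℕ → ℕ → ℝ) → ℂ}
    (hfg : ∀ lam, g (particle θ (reflectArray N k M lam)) = f (particle θ lam)) :
    gtExp N k M θ (reflectWeight M θ w) g = gtExp N k M θ w f := by
  have hZ : gtPartition N k M θ (reflectWeight M θ w) = gtPartition N k M θ w := by
    unfold gtPartition
    rw [← sum_gtArrays_reflect]
    exact sum_congr rfl fun lam _ => gtWeight_reflect hkN θ w lam
  unfold gtExp gtProb
  rw [hZ, ← sum_gtArrays_reflect]
  exact sum_congr rfl fun lam _ => by rw [gtWeight_reflect hkN, hfg]

set_option maxHeartbeats 1000000 in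
theorem nekRes1_reflect {N k M : ℕ} {θ : ℝ} (hk : 1 ≤ k) (hkN : k ≤ N) (w : ℕ → ℝ → ℂ)
    (φ : ℕ → ℂ → ℂ) (z : ℂ) :
    nekRes1 N k M θ (reflectWeight M θ w) (fun j x => φ j (reflectPoint N M θ x))
        (reflectPoint N M θ z) = nekRes2 N k M θ w φ z := by
  have p1 : reflectPoint N M θ (-(N * θ)) = ((M + 1 - θ : ℝ) : ℂ) := by
    unfold reflectPoint; push_cast; ring
  have p2 : reflectPoint N M θ ((M + 1 - θ : ℝ) : ℂ) = -(N * θ) := by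
    unfold reflectPoint; push_cast; ring
  have d1 : reflectPoint N M θ z + N * θ = -(z - ((M + 1 - θ : ℝ) : ℂ)) := by
    unfold reflectPoint; push_cast; ring
  have d2 : reflectPoint N M θ z - ((M + 1 - θ : ℝ) : ℂ) = -(z + N * θ) := by
    unfold reflectPoint; push_cast; ring
  unfold nekRes1 nekRes2
  simp only [p1, p2, d1, d2]
  congr 1
  · congr 1
    · congr 1
      · rw [div_neg, neg_mul, neg_div, neg_neg]
      · refine gtExp_reflect hkN θ w fun lam => ?_
        congr 1
        · rw [← prod_Icc_two_reflect]
          refine prod_congr rfl fun p hp => ?_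
          rw [mem_Icc] at hp
          rw [particle_reflectArray' θ lam hkN le_rfl (by rw [mem_Icc]; omega)]
          push_cast
          congr 1 <;> ring
        · rw [particle_reflectArray θ lam hkN le_rfl (by rw [mem_Icc]; omega),
            Nat.add_sub_cancel_left]
          refine if_congr ⟨fun h => ?_, fun h => ?_⟩ rfl rfl <;> linarith
    · congr 1
      · rw [div_neg, neg_mul, neg_div]
      · refine gtExp_reflect hkN θ w fun lam => ?_
        congr 1
        · rw [← prod_Icc_two_reflect]
          refine prod_congr rfl fun p hp => ?_
          rw [mem_Icc] at hp
          rw [particle_reflectArray θ lam le_rfl hkN (by rw [mem_Icc]; omega)]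
          push_cast
          congr 1 <;> ring
        · rw [particle_reflectArray θ lam le_rfl hkN (by rw [mem_Icc]; omega),
            Nat.add_sub_cancel]
          refine if_congr ⟨fun h => ?_, fun h => ?_⟩ rfl rfl <;> linarith
  · refine sum_congr rfl fun j hj => ?_
    rw [mem_Icc] at hj
    refine congrArg₂ (· * ·) ?_ ?_
    · rw [div_neg, neg_mul, neg_div]
    · refine gtExp_reflect hkN θ w fun lam => ?_
      congr 1
      · congr 1
        · rw [← prod_Icc_two_reflect]
          refine prod_congr rfl fun p hp => ?_
          rw [mem_Icc] at hp
          rw [particle_reflectArray θ lam (by omega) hj.2 (by rw [mem_Icc]; omega)]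
          push_cast
          congr 1 <;> ring
        · rw [← prod_Icc_one_reflect (j - 1)]
          refine prod_congr rfl fun p hp => ?_
          rw [particle_reflectArray' θ lam (by omega) (by omega) hp,
            Nat.cast_sub (by omega)]
          push_cast
          congr 1 <;> ring
      · rw [particle_reflectArray θ lam (by omega) hj.2 (by rw [mem_Icc]; omega),
          Nat.add_sub_cancel]
        refine if_congr ⟨fun h => ?_, fun h => ?_⟩ rfl rfl <;> linarith

theorem nekR1_reflect {N k M : ℕ} {θ : ℝ} (hk : 1 ≤ k) (hkN : k ≤ N) (w : ℕ → ℝ → ℂ)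
    (φ : ℕ → ℂ → ℂ) (z : ℂ) :
    nekR1 N k M θ (reflectWeight M θ w) (fun j x => φ j (reflectPoint N M θ x))
        (reflectPoint N M θ z) = nekR2 N k M θ w φ z := by
  have p1 : reflectPoint N M θ (reflectPoint N M θ z) = z := by
    unfold reflectPoint; ring
  unfold nekR1 nekR2
  rw [nekRes1_reflect hk hkN]
  simp only [p1]
  refine congrArg₂ (· - ·) (congrArg₂ (· + ·) (congrArg₂ (· + ·) ?_ ?_) ?_) rfl
  · refine congrArg₂ (· * ·) rfl ?_
    refine gtExp_reflect hkN θ w fun lam => ?_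
    rw [← prod_Icc_one_reflect N]
    refine prod_congr rfl fun p hp => ?_
    rw [particle_reflectArray' θ lam hkN le_rfl hp, ← neg_div_neg_eq, reflectPoint]
    push_cast
    congr 1 <;> ring
  · refine congrArg₂ (· * ·) rfl ?_
    refine gtExp_reflect hkN θ w fun lam => ?_
    rw [← prod_Icc_one_reflect k]
    refine prod_congr rfl fun p hp => ?_
    rw [particle_reflectArray' θ lam le_rfl hkN hp, ← neg_div_neg_eq, reflectPoint]
    push_cast
    congr 1 <;> ring
  · refine congrArg₂ (· * ·) rfl ?_
    refine sum_congr rfl fun j hj => ?_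
    rw [mem_Icc] at hj
    refine congrArg₂ (· * ·) rfl ?_
    refine gtExp_reflect hkN θ w fun lam => ?_
    congr 1
    · rw [← prod_Icc_one_reflect j]
      refine prod_congr rfl fun p hp => ?_
      rw [particle_reflectArray' θ lam (by omega) hj.2 hp, ← neg_div_neg_eq, reflectPoint]
      push_cast
      congr 1 <;> ring
    · rw [← prod_Icc_one_reflect (j - 1)]
      refine prod_congr rfl fun p hp => ?_
      rw [particle_reflectArray' θ lam (by omega) (by omega) hp, ← neg_div_neg_eq, reflectPoint,
        Nat.cast_sub (by omega)]
      push_cast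
      congr 1 <;> ring

theorem reflectPoint_mem_nekLattice {N M : ℕ} {θ : ℝ} {z : ℂ}
    (h : reflectPoint N M θ z ∈ nekLattice N M θ) : z ∈ nekLattice N M θ := by
  obtain ⟨a, b, ha, hb1, hbN, e⟩ := h
  refine ⟨M + 1 - a, N + 1 - b, by omega, by omega, by omega, ?_⟩
  rw [Nat.cast_sub ha, Nat.cast_sub (by omega)]
  unfold reflectPoint at e
  push_cast
  linear_combination -e

/-- `R₂` extends analytically, being the expression `R₁` for the reflected data. -/
theorem exists_analyticOnNhd_nekR2 {N k M : ℕ} {θ : ℝ} (hk : 1 ≤ k) (hkN : k ≤ N) (hθ : 0 < θ)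
    (hθ1 : θ ≠ 1) (w : ℕ → ℝ → ℂ) {U : Set ℂ} (hU : IsOpen U) (φ : ℕ → ℂ → ℂ)
    (hφ : ∀ j, k ≤ j → j ≤ N + 1 → AnalyticOnNhd ℂ (φ j) U)
    (hr : ∀ j, k ≤ j → j ≤ N → ∀ x ∈ Set.Icc (1 - N * θ) (M - ((N : ℝ) - j + 1) * θ),
      φ j (x : ℂ) * w j (x + ((N : ℝ) - j) * θ) =
        φ (j + 1) (x : ℂ) * w j (x + ((N : ℝ) - j) * θ - 1)) :
    ∃ G : ℂ → ℂ, AnalyticOnNhd ℂ G U ∧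
      ∀ z ∈ U, z ∉ nekLattice N M θ → G z = nekR2 N k M θ w φ z := by
  have hinv : ∀ z, reflectPoint N M θ (reflectPoint N M θ z) = z := by
    intro z
    unfold reflectPoint
    ring
  have han : AnalyticOnNhd ℂ (reflectPoint N M θ) Set.univ := by
    intro z _
    unfold reflectPoint
    fun_prop
  have hcont : Continuous (reflectPoint N M θ) := by
    unfold reflectPoint
    fun_prop
  obtain ⟨G, hG, hGR⟩ := exists_analyticOnNhd_nekR1 (M := M) hk hkN hθ hθ1 (reflectWeight M θ w)
    (hU.preimage hcont) (fun j x => φ j (reflectPoint N M θ x))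
    (fun j h1 h2 => (hφ j h1 h2).comp (han.mono (Set.subset_univ _)) fun z hz => hz) (by
      intro j h1 h2 x hx
      have h3 := hr j h1 h2 (M + 1 - (N + 1) * θ - x) ⟨by nlinarith [hx.2], by nlinarith [hx.1]⟩
      unfold reflectWeight
      have e1 : ((M + 1 - (N + 1) * θ - x : ℝ) : ℂ) = reflectPoint N M θ x := by
        unfold reflectPoint
        push_cast
        ring
      rw [e1] at h3
      rw [show (M : ℝ) - (x - 1) - (j + 1) * θ = M + 1 - (N + 1) * θ - x + (N - j) * θ by ring,
        show (M : ℝ) - x - (j + 1) * θ = M + 1 - (N + 1) * θ - x + (N - j) * θ - 1 by ring]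
      exact h3.symm)
  refine ⟨fun z => G (reflectPoint N M θ z), ?_, fun z hz hzL => ?_⟩
  · exact hG.comp (han.mono (Set.subset_univ _)) fun z hz => by
      rw [Set.mem_preimage, hinv]
      exact hz
  · dsimp only
    rw [hGR _ (by rw [Set.mem_preimage, hinv]; exact hz)
      (fun h => hzL (reflectPoint_mem_nekLattice h)), nekR1_reflect hk hkN]

theorem theorem2p1 (N k M : ℕ) (θ : ℝ) (hk : 1 ≤ k) (hkN : k ≤ N) (hθ : 0 < θ) (hθ1 : θ ≠ 1)
    (w : ℕ → ℝ → ℂ)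
    (hw : ∀ j, k ≤ j → j ≤ N → ∀ x ∈ Set.Icc (-(j * θ)) (M - θ), w j x ≠ 0)
    (hZ : gtPartition N k M θ w ≠ 0)
    (𝓜 : Set ℂ) (hopen : IsOpen 𝓜)
    (hseg : ∀ x ∈ Set.Icc (-(N * θ)) (M + 1 - θ), (x : ℂ) ∈ 𝓜)
    (φ₁ φ₂ : ℕ → ℂ → ℂ)
    (hφ₁ : ∀ j, k ≤ j → j ≤ N + 1 → AnalyticOnNhd ℂ (φ₁ j) 𝓜)
    (hφ₂ : ∀ j, k ≤ j → j ≤ N + 1 → AnalyticOnNhd ℂ (φ₂ j) 𝓜)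
    (hr₁ : ∀ j, k ≤ j → j ≤ N → ∀ x ∈ Set.Icc (1 - j * θ) (M - θ),
      φ₁ (j + 1) (x : ℂ) * w j x = φ₁ j (x : ℂ) * w j (x - 1))
    (hr₂ : ∀ j, k ≤ j → j ≤ N → ∀ x ∈ Set.Icc (1 - N * θ) (M - ((N : ℝ) - j + 1) * θ),
      φ₂ j (x : ℂ) * w j (x + ((N : ℝ) - j) * θ) =
        φ₂ (j + 1) (x : ℂ) * w j (x + ((N : ℝ) - j) * θ - 1)) :
    (∃ G₁ : ℂ → ℂ, AnalyticOnNhd ℂ G₁ 𝓜 ∧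
      ∀ z ∈ 𝓜, z ∉ nekLattice N M θ → G₁ z = nekR1 N k M θ w φ₁ z) ∧
    (∃ G₂ : ℂ → ℂ, AnalyticOnNhd ℂ G₂ 𝓜 ∧
      ∀ z ∈ 𝓜, z ∉ nekLattice N M θ → G₂ z = nekR2 N k M θ w φ₂ z) := by
  exact ⟨exists_analyticOnNhd_nekR1 hk hkN hθ hθ1 w hopen φ₁ hφ₁ hr₁,
    exists_analyticOnNhd_nekR2 hk hkN hθ hθ1 w hopen φ₂ hφ₂ hr₂⟩
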